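/- Consider the 3-Majority process on the complete graph with $n \ge 1$ nodes. Initially each node supports one of at most $n$ colors. The process runs in synchronous rounds. In every round, each node, independently of all other nodes and of all previous rounds, samples three nodes independently and uniformly at random (with replacement, from all $n$ nodes). If some color is supported (at the beginning of the round) by at least two of the three samples, the node adopts that color; otherwise it adopts the color of one of the three samples, chosen uniformly at random. Consensus is reached at the first time at which all nodes support the same color. Theorem. There is an absolute constant $C > 0$ such that, for every $n \ge 1$ and every initial assignment of (at most $n$) colors to the $n$ nodes, 3-Majority reaches consensus within $C\, n^{3/4} (\log n)^{7/8}$ rounds with probability at least $1 - 1/n$. -/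

import Mathlib

open MeasureTheory

noncomputable section

namespace ThreeMajority

/-- A state of the system of `n` nodes: every node supports one of the (up to `n`) colors.
The configuration vector `(c_i)` of a state `χ` is `c_i = #{v | χ v = i}`. -/
abbrev Coloring (n : ℕ) : Type := Fin n → Fin n

/-- Consensus: all nodes support the same color. -/
def IsConsensus {n : ℕ} (χ : Coloring n) : Prop :=
  ∃ color : Fin n, ∀ v : Fin n, χ v = color

/-- The random choices of one node in one round: the three sampled nodes, and which one of the
three samples it follows if their colors are pairwise distinct. -/
abbrev NodeChoice (n : ℕ) : Type := (Fin 3 → Fin n) × Fin 3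

/-- The color adopted by a node that has seen the colors `x 0`, `x 1`, `x 2`: the color supported
by at least two of the samples if there is one, and otherwise the color of sample `r`. -/
def adopt {n : ℕ} (x : Fin 3 → Fin n) (r : Fin 3) : Fin n :=
  if x 0 = x 1 then x 0
  else if x 0 = x 2 then x 0
  else if x 1 = x 2 then x 1
  else x r

/-- One synchronous round of 3-Majority in the state `χ`, where node `v` makes the
choices `s v`. -/
def step {n : ℕ} (χ : Coloring n) (s : Fin n → NodeChoice n) : Coloring n :=
  fun v ↦ adopt (fun j ↦ χ ((s v).1 j)) (s v).2

/-- The state after `t` rounds, started in `χ`, where node `v` makes the choices `ω t v` in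
the round that leads from time `t` to time `t + 1`. -/
def run {n : ℕ} (χ : Coloring n) (ω : ℕ → Fin n → NodeChoice n) : ℕ → Coloring n
  | 0 => χ
  | t + 1 => step (run χ ω t) (ω t)

/-- The law of the choices of one node in one round: three independent uniformly random nodes
(drawn with replacement from all nodes) and an independent uniformly random index. -/
def nodeLaw (n : ℕ) [NeZero n] : Measure (NodeChoice n) :=
  (PMF.uniformOfFintype (NodeChoice n)).toMeasure

instance (n : ℕ) [NeZero n] : IsProbabilityMeasure (nodeLaw n) :=
  PMF.toMeasure.isProbabilityMeasure _

/-- The law of all random choices: independent over all rounds and all nodes. -/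
def law (n : ℕ) [NeZero n] : Measure (ℕ → Fin n → NodeChoice n) :=
  Measure.infinitePi fun _ : ℕ ↦ Measure.pi fun _ : Fin n ↦ nodeLaw n

instance (n : ℕ) [NeZero n] : IsProbabilityMeasure (law n) := by
  unfold law; infer_instance

end ThreeMajority

end

/-!
The proof exhibits a nonnegative function `Φ` on the states, bounded by `O (n ^ (2 / 3) * log n)` up
to terms of lower order, whose expectation decreases by at least `1` in each round before
consensus. By additive drift (`mul_iterate_avg_unsettled_le`) the process is then settled after
twice that bound with probability at least one half from any state, and repeating this `O (log n)`
times gives the error `1 / n` (`one_sub_inv_le_measureReal_isConsensus`). The resulting bound is of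
smaller order than `n ^ (3 / 4)`.

Write `α i` for the fraction of color `i` and `γ = ∑ i, α i ^ 2`. Given the state, the nodes adopt
color `i` independently with probability `α i * (1 + α i - γ)` (`expect_nodeColor_eq`). The
potential has two parts, separated by a threshold `k` of about `n ^ (1 / 3)` for the number of
surviving colors, which never increases.

While more than `k` colors survive, the Shannon entropy of `α` decreases. Selection does not
increase it, because `log (α i)` and `α i - γ` are positively correlated under the weights `α i`,
and by strict concavity the sampling noise decreases it by a multiple of `1 / n` for every
surviving color (`entropy_drift`). As the entropy is at most `log n`, this part takes
`O (n * log n / k)` rounds. The argument breaks down if one color dominates, where instead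
`log (1 + n * (1 - γ))` decreases (`log_disagree_drift`).

While exactly `j ≤ k` colors survive, let `μ` be the smallest of their fractions. One has
`μ ≤ 1 / j ≤ γ`, so `μ` is a supermartingale, and `log (1 + n * μ)` decreases by a multiple of
`1 / j` if `μ` is well below `1 / j` (`log_minFrac_drift`). Otherwise all surviving colors have
fractions of order at least `1 / j`, and then the excess `γ - 1 / j` grows by a factor
`1 + Ω (1 / j)` through selection and by `Ω (1 / n)` through noise; hence
`log (γ - 1 / j + b)` increases by `Ω (1 / (j + log n))` for a suitable `b` of order `log n / n`
(`log_agree_drift`). The latter quantity is a submartingale in any case, so that the difference of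
the two logarithms is a potential for the loss of a color (`lossPotential_drift`). Since it ranges
over an interval of length `O (log n)`, losing all but one of the last `k` colors takes
`O (k * (k + log n) * log n)` rounds.

For the finitely many small `n`, it suffices that consensus is possible in one round.
-/

namespace ThreeMajority

open Finset BigOperators ProbabilityTheory

/-! ### Finite expectations -/

lemma expect_mono {α : Type*} [Fintype α] {f g : α → ℝ} (h : ∀ x, f x ≤ g x) :
    𝔼 x, f x ≤ 𝔼 x, g x :=
  Finset.expect_le_expect fun x _ ↦ h x

lemma expect_nonneg' {α : Type*} [Fintype α] {f : α → ℝ} (h : ∀ x, 0 ≤ f x) :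
    0 ≤ 𝔼 x, f x :=
  Finset.expect_nonneg fun x _ ↦ h x

/-- Jensen's inequality for the logarithm. -/
lemma expect_log_le {α : Type*} [Fintype α] [Nonempty α] {f : α → ℝ} (hf : ∀ x, 0 < f x) {c : ℝ}
    (hc : 𝔼 x, f x ≤ c) : 𝔼 x, Real.log (f x) ≤ Real.log c := by
  have hm : 0 < 𝔼 x, f x := Finset.expect_pos (fun x _ ↦ hf x) univ_nonempty
  refine le_trans ?_ (Real.log_le_log hm hc)
  set m := 𝔼 x, f x with hmdef
  calc 𝔼 x, Real.log (f x) ≤ 𝔼 x, (Real.log m + (f x / m - 1)) := by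
        refine expect_mono fun x ↦ ?_
        have h := Real.log_le_sub_one_of_pos (div_pos (hf x) hm)
        rw [Real.log_div (hf x).ne' hm.ne'] at h
        linarith
    _ = Real.log m := by
        rw [expect_add_distrib, expect_sub_distrib, Fintype.expect_const, Fintype.expect_const,
          ← expect_div, ← hmdef, div_self hm.ne']
        ring

/-! ### Moments of sums of independent centred variables -/

section Moments

variable {Ω : Type*} [Fintype Ω]

lemma expect_cons (m : ℕ) (F : (Fin (m + 1) → Ω) → ℝ) :
    𝔼 s, F s = 𝔼 s : Fin m → Ω, 𝔼 a, F (Fin.cons a s) := by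
  rw [expect_comm, ← Finset.expect_product']
  exact (Fintype.expect_equiv (Fin.consEquiv (fun _ ↦ Ω)) _ _ (fun x ↦ rfl)).symm

variable [Nonempty Ω] {g : Ω → ℝ}

lemma expect_sum_eq_zero (hg : 𝔼 a, g a = 0) (m : ℕ) :
    𝔼 s : Fin m → Ω, ∑ v, g (s v) = 0 := by
  induction m with
  | zero => simp
  | succ m ih =>
    rw [expect_cons]
    simp only [Fin.sum_univ_succ, Fin.cons_zero, Fin.cons_succ, expect_add_distrib, hg,
      Fintype.expect_const, ih, add_zero]

lemma expect_sum_sq (hg : 𝔼 a, g a = 0) (m : ℕ) :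
    𝔼 s : Fin m → Ω, (∑ v, g (s v)) ^ 2 = m * 𝔼 a, g a ^ 2 := by
  induction m with
  | zero => simp
  | succ m ih =>
    rw [expect_cons]
    simp only [Fin.sum_univ_succ, Fin.cons_zero, Fin.cons_succ, add_sq, expect_add_distrib,
      ← expect_mul, ← mul_expect, hg, Fintype.expect_const, ih]
    push_cast
    ring

lemma expect_sum_cube (hg : 𝔼 a, g a = 0) (m : ℕ) :
    𝔼 s : Fin m → Ω, (∑ v, g (s v)) ^ 3 = m * 𝔼 a, g a ^ 3 := by
  induction m with
  | zero => simp
  | succ m ih =>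
    rw [expect_cons]
    have e : ∀ x y : ℝ, (x + y) ^ 3 = x ^ 3 + 3 * (x ^ 2 * y) + 3 * (x * y ^ 2) + y ^ 3 := by
      intros; ring
    simp only [Fin.sum_univ_succ, Fin.cons_zero, Fin.cons_succ, e, expect_add_distrib,
      ← expect_mul, ← mul_expect, hg, Fintype.expect_const, ih, expect_sum_eq_zero hg]
    push_cast
    ring

/-- The second moment of the Euclidean length of a sum of centred vectors. -/
lemma expect_sum_sum_sq {ι : Type*} [Fintype ι] {h : ι → Ω → ℝ} (hh : ∀ i, 𝔼 a, h i a = 0)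
    (m : ℕ) :
    𝔼 s : Fin m → Ω, ∑ i, (∑ v, h i (s v)) ^ 2 = m * 𝔼 a, ∑ i, h i a ^ 2 := by
  rw [expect_sum_comm, expect_sum_comm, mul_sum]
  exact sum_congr rfl fun i _ ↦ expect_sum_sq (hh i) m

/-- The fourth moment of the Euclidean length of a sum of independent centred vectors whose
squared length is at most `2` is at most quadratic in the number of summands. -/
lemma expect_sum_sum_sq_sq {ι : Type*} [Fintype ι] {h : ι → Ω → ℝ}
    (hh : ∀ i, 𝔼 a, h i a = 0) (h2 : ∀ a, ∑ i, h i a ^ 2 ≤ 2) (hv : 𝔼 a, ∑ i, h i a ^ 2 ≤ 1)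
    (m : ℕ) :
    𝔼 s : Fin m → Ω, (∑ i, (∑ v, h i (s v)) ^ 2) ^ 2 ≤ 5 * (m : ℝ) ^ 2 * 𝔼 a, ∑ i, h i a ^ 2 := by
  have hv0 : 0 ≤ 𝔼 a, ∑ i, h i a ^ 2 := expect_nonneg' fun a ↦ sum_nonneg fun i _ ↦ sq_nonneg _
  induction m with
  | zero => simp
  | succ m ih =>
    rw [expect_cons]
    simp only [Fin.sum_univ_succ, Fin.cons_zero, Fin.cons_succ]
    have hsq := expect_sum_sum_sq hh m
    set v := 𝔼 a, ∑ i, h i a ^ 2 with hvdef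
    set S : (Fin m → Ω) → ι → ℝ := fun s i ↦ ∑ v, h i (s v) with hS
    -- The mixed term that is odd in the new summand averages out; the one that is odd in the
    -- old sum is kept, and averages out afterwards.
    have pt : ∀ (s : Fin m → Ω) (a : Ω), (∑ i, (h i a + S s i) ^ 2) ^ 2 ≤
        (∑ i, S s i ^ 2) ^ 2 + 6 * ((∑ i, S s i ^ 2) * ∑ i, h i a ^ 2) + 2 * ∑ i, h i a ^ 2
          + 4 * ∑ i, ((∑ j, S s j ^ 2) * S s i) * h i a
          + 4 * ∑ i, S s i * (h i a * ∑ j, h j a ^ 2) := by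
      intro s a
      have e : ∑ i, (h i a + S s i) ^ 2 =
          ∑ i, S s i ^ 2 + 2 * ∑ i, S s i * h i a + ∑ i, h i a ^ 2 := by
        rw [mul_sum, ← sum_add_distrib, ← sum_add_distrib]
        exact sum_congr rfl fun i _ ↦ by ring
      have e1 : ∑ i, ((∑ j, S s j ^ 2) * S s i) * h i a =
          (∑ j, S s j ^ 2) * ∑ i, S s i * h i a := by
        rw [mul_sum]; exact sum_congr rfl fun i _ ↦ by ring
      have e2 : ∑ i, S s i * (h i a * ∑ j, h j a ^ 2) =
          (∑ i, S s i * h i a) * ∑ j, h j a ^ 2 := by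
        rw [sum_mul]; exact sum_congr rfl fun i _ ↦ by ring
      rw [e, e1, e2]
      have cs := sum_mul_sq_le_sq_mul_sq univ (S s) (fun i ↦ h i a)
      have ha : 0 ≤ ∑ i, h i a ^ 2 := sum_nonneg fun i _ ↦ sq_nonneg _
      nlinarith [h2 a]
    calc _ ≤ 𝔼 s : Fin m → Ω, 𝔼 a, ((∑ i, S s i ^ 2) ^ 2
          + 6 * ((∑ i, S s i ^ 2) * ∑ i, h i a ^ 2) + 2 * ∑ i, h i a ^ 2
          + 4 * ∑ i, ((∑ j, S s j ^ 2) * S s i) * h i a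
          + 4 * ∑ i, S s i * (h i a * ∑ j, h j a ^ 2)) :=
          expect_mono fun s ↦ expect_mono fun a ↦ pt s a
      _ = 𝔼 s : Fin m → Ω, (∑ i, S s i ^ 2) ^ 2
          + 6 * ((𝔼 s : Fin m → Ω, ∑ i, S s i ^ 2) * v) + 2 * v := by
          have z : ∀ i, 𝔼 s : Fin m → Ω, S s i = 0 := fun i ↦ expect_sum_eq_zero (hh i) m
          simp only [expect_add_distrib, ← mul_expect, ← expect_mul, Fintype.expect_const,
            expect_sum_comm _ univ, hh, mul_zero, sum_const_zero, add_zero, z, zero_mul]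
          simp only [hvdef, expect_sum_comm]
      _ ≤ _ := by
          rw [hsq]
          push_cast
          nlinarith [mul_nonneg (Nat.cast_nonneg (α := ℝ) m) hv0,
            mul_nonneg (mul_nonneg (Nat.cast_nonneg (α := ℝ) m) hv0) (sub_nonneg.2 hv)]

end Moments

/-! ### Color fractions and the adoption probabilities -/

/-- The fraction of the nodes that support color `i`. -/
noncomputable def frac {n : ℕ} (χ : Coloring n) (i : Fin n) : ℝ := 𝔼 v, if χ v = i then 1 else 0

/-- The probability `∑ i, α i ^ 2` that two random nodes agree. -/
noncomputable def agree {n : ℕ} (χ : Coloring n) : ℝ := ∑ i, frac χ i ^ 2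

/-- The probability that a node adopts color `i` in the next round; see `expect_nodeColor_eq`. -/
noncomputable def adoptProb {n : ℕ} (χ : Coloring n) (i : Fin n) : ℝ :=
  frac χ i * (1 + frac χ i - agree χ)

/-- The color adopted by a node that makes the choices `a`. -/
def nodeColor {n : ℕ} (χ : Coloring n) (a : NodeChoice n) : Fin n :=
  adopt (fun j ↦ χ (a.1 j)) a.2

lemma expect_fin_three {Ω : Type*} [Fintype Ω] (F : Ω → Ω → Ω → ℝ) :
    𝔼 x : Fin 3 → Ω, F (x 0) (x 1) (x 2) = 𝔼 c, 𝔼 b, 𝔼 a, F a b c := by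
  rw [expect_cons]
  have h1 (s : Fin 2 → Ω) : 𝔼 a, F ((Fin.cons a s : Fin 3 → Ω) 0) ((Fin.cons a s : Fin 3 → Ω) 1)
      ((Fin.cons a s : Fin 3 → Ω) 2) = 𝔼 a, F a (s 0) (s 1) := rfl
  simp only [h1]
  rw [expect_cons]
  have h2 (s : Fin 1 → Ω) : 𝔼 b, 𝔼 a, F a ((Fin.cons b s : Fin 2 → Ω) 0)
      ((Fin.cons b s : Fin 2 → Ω) 1) = 𝔼 b, 𝔼 a, F a b (s 0) := rfl
  simp only [h2]
  rw [expect_cons]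
  simp

section

variable {n : ℕ} (χ : Coloring n)

lemma sum_frac [NeZero n] : ∑ i, frac χ i = 1 := by
  unfold frac
  rw [← expect_sum_comm]
  simp

lemma frac_nonneg (i : Fin n) : 0 ≤ frac χ i :=
  expect_nonneg' fun v ↦ by split_ifs <;> norm_num

lemma frac_le_one [NeZero n] (i : Fin n) : frac χ i ≤ 1 := by
  rw [← sum_frac χ]
  exact single_le_sum (f := frac χ) (fun j _ ↦ frac_nonneg χ j) (mem_univ i)

lemma expect_agree_pair :
    𝔼 v, 𝔼 w, (if χ v = χ w then (1 : ℝ) else 0) = agree χ := by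
  have h : ∀ v w, (if χ v = χ w then (1 : ℝ) else 0) =
      ∑ j, (if χ v = j then 1 else 0) * (if χ w = j then 1 else 0) := by
    intro v w
    simp [eq_comm]
  simp only [h, expect_sum_comm, ← mul_expect, ← expect_mul, agree, frac, sq]

/-- A node adopts color `i` with probability `α i * (1 + α i - ∑ j, α j ^ 2)`. -/
lemma expect_nodeColor_eq [NeZero n] (i : Fin n) :
    𝔼 a, (if nodeColor χ a = i then (1 : ℝ) else 0) = adoptProb χ i := by
  -- For equal weights on the three samples, the rule is a mixture of three rules of the kind
  -- "adopt the color of two given samples if they agree, and that of the third one otherwise".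
  have pt : ∀ a b c : Fin n, ∀ x : Fin 3 → Fin n, x 0 = a → x 1 = b → x 2 = c →
      𝔼 r, (if adopt (fun j ↦ χ (x j)) r = i then (1 : ℝ) else 0) =
      1 / 3 * ((if χ a = i then 1 else 0) * (if χ b = i then 1 else 0)
        + (1 - if χ a = χ b then 1 else 0) * (if χ c = i then 1 else 0)
        + ((if χ a = i then 1 else 0) * (if χ c = i then 1 else 0)
        + (1 - if χ a = χ c then 1 else 0) * (if χ b = i then 1 else 0))
        + ((if χ b = i then 1 else 0) * (if χ c = i then 1 else 0)
        + (1 - if χ b = χ c then 1 else 0) * (if χ a = i then 1 else 0))) := by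
    intro a b c x ha hb hc
    rw [Fintype.expect_eq_sum_div_card, Fin.sum_univ_three]
    simp only [adopt, ha, hb, hc, Fintype.card_fin]
    by_cases hab : χ a = χ b <;> by_cases hac : χ a = χ c <;> by_cases hbc : χ b = χ c <;>
      by_cases h1 : χ a = i <;> by_cases h2 : χ b = i <;> by_cases h3 : χ c = i <;>
      simp_all <;> norm_num
  have hprod : 𝔼 a : NodeChoice n, (if nodeColor χ a = i then (1 : ℝ) else 0) =
      𝔼 x : Fin 3 → Fin n, 𝔼 r, (if adopt (fun j ↦ χ (x j)) r = i then (1 : ℝ) else 0) := by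
    rw [← univ_product_univ, expect_product]
    rfl
  rw [hprod]
  simp only [fun x : Fin 3 → Fin n ↦ pt _ _ _ x rfl rfl rfl]
  rw [expect_fin_three (fun a b c : Fin n ↦
    1 / 3 * ((if χ a = i then 1 else 0) * (if χ b = i then 1 else 0)
        + (1 - if χ a = χ b then (1 : ℝ) else 0) * (if χ c = i then 1 else 0)
        + ((if χ a = i then 1 else 0) * (if χ c = i then 1 else 0)
        + (1 - if χ a = χ c then 1 else 0) * (if χ b = i then 1 else 0))
        + ((if χ b = i then 1 else 0) * (if χ c = i then 1 else 0)
        + (1 - if χ b = χ c then 1 else 0) * (if χ a = i then 1 else 0))))]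
  have hF : ∀ j, 𝔼 v, (if χ v = j then (1 : ℝ) else 0) = frac χ j := fun _ ↦ rfl
  have hD : 𝔼 v, frac χ (χ v) = agree χ := by
    rw [← expect_agree_pair, expect_comm]
    rfl
  simp only [sub_mul, one_mul, expect_add_distrib, expect_sub_distrib, ← mul_expect, ← expect_mul,
    Fintype.expect_const, hF, hD]
  rw [adoptProb]
  ring

/-- The law of the color adopted by a node, as an average of a function of that color. -/
lemma expect_nodeColor [NeZero n] (f : Fin n → ℝ) :
    𝔼 a, f (nodeColor χ a) = ∑ i, adoptProb χ i * f i := by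
  have h : ∀ a, f (nodeColor χ a) = ∑ i, (if nodeColor χ a = i then (1 : ℝ) else 0) * f i := by
    intro a; simp
  simp only [h, expect_sum_comm, ← expect_mul, expect_nodeColor_eq]

lemma frac_step (s : Fin n → NodeChoice n) (i : Fin n) :
    frac (step χ s) i = (∑ v, if nodeColor χ (s v) = i then (1 : ℝ) else 0) / n := by
  rw [frac, Fintype.expect_eq_sum_div_card, Fintype.card_fin]
  rfl

end

/-! ### The transition operator -/

/-- The transition operator of the process: `avg f χ` is the expectation of `f` at the state
after one round, started in `χ`. -/
noncomputable def avg {n : ℕ} (f : Coloring n → ℝ) (χ : Coloring n) : ℝ :=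
  𝔼 s : Fin n → NodeChoice n, f (step χ s)

section

variable {n : ℕ}

lemma avg_mono {f g : Coloring n → ℝ} (h : ∀ χ, f χ ≤ g χ) (χ : Coloring n) :
    avg f χ ≤ avg g χ :=
  expect_mono fun _ ↦ h _

lemma integral_pi_nodeLaw [NeZero n] (f : (Fin n → NodeChoice n) → ℝ) :
    ∫ s, f s ∂(Measure.pi fun _ : Fin n ↦ nodeLaw n) = 𝔼 s, f s := by
  rw [integral_fintype .of_finite, Fintype.expect_eq_sum_div_card, sum_div]
  refine sum_congr rfl fun s _ ↦ ?_
  have : (Measure.pi fun _ : Fin n ↦ nodeLaw n).real {s} =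
      ((Fintype.card (Fin n → NodeChoice n) : ℝ))⁻¹ := by
    rw [Measure.real, Measure.pi_singleton]
    simp only [nodeLaw]
    rw [Finset.prod_congr rfl fun v _ ↦ PMF.toMeasure_apply_singleton _ _ (by measurability)]
    simp only [PMF.uniformOfFintype_apply, prod_const, card_univ, Fintype.card_fun,
      ENNReal.toReal_pow, ENNReal.toReal_inv, ENNReal.toReal_natCast]
    push_cast
    rw [inv_pow]
  rw [this, smul_eq_mul]
  ring

lemma run_congr (χ : Coloring n) {ω ω' : ℕ → Fin n → NodeChoice n} {t : ℕ}
    (h : ∀ u < t, ω u = ω' u) : run χ ω t = run χ ω' t := by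
  induction t with
  | zero => rfl
  | succ t ih => rw [run, run, ih fun u hu ↦ h u (by omega), h t (by omega)]

/-- The Markov property: the expectation of `f` after `t` rounds is the `t`-th iterate of the
transition operator. -/
lemma integral_run [NeZero n] (χ : Coloring n) (t : ℕ) (f : Coloring n → ℝ) :
    ∫ ω, f (run χ ω t) ∂(law n) = avg^[t] f χ := by
  induction t generalizing f with
  | zero => simp [run]
  | succ t ih =>
    rw [Function.iterate_succ_apply, ← ih]
    have hind : iIndepFun (fun (u : ℕ) (ω : ℕ → Fin n → NodeChoice n) ↦ ω u) (law n) :=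
      iIndepFun_infinitePi (P := fun _ : ℕ ↦ Measure.pi fun _ : Fin n ↦ nodeLaw n)
        (X := fun _ x ↦ x) fun _ ↦ measurable_id
    have h2 := hind.indepFun_finset (range t) {t} (by simp) fun u ↦ measurable_pi_apply u
    -- The state at time `t`, as a function of the choices made before time `t`.
    let ext : ((u : range t) → Fin n → NodeChoice n) → ℕ → Fin n → NodeChoice n :=
      fun x u ↦ if h : u ∈ range t then x ⟨u, h⟩ else fun _ ↦ (fun _ ↦ 0, 0)
    have hrun : ∀ ω : ℕ → Fin n → NodeChoice n,
        run χ ω t = run χ (ext fun u ↦ ω u) t := by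
      intro ω
      refine run_congr χ fun u hu ↦ ?_
      simp [ext, hu]
    have h3 : IndepFun (fun ω ↦ run χ ω t) (fun ω ↦ ω t) (law n) := by
      have := h2.comp (φ := fun x ↦ run χ (ext x) t)
        (ψ := fun y : ((u : ({t} : Finset ℕ)) → Fin n → NodeChoice n) ↦ y ⟨t, by simp⟩)
        (measurable_of_countable _) (measurable_of_countable _)
      convert this using 1
      · exact funext hrun
      · rfl
    have hm1 : Measurable fun ω : ℕ → Fin n → NodeChoice n ↦ run χ ω t := by
      have : (fun ω : ℕ → Fin n → NodeChoice n ↦ run χ ω t) =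
          (fun x ↦ run χ (ext x) t) ∘ fun ω (u : range t) ↦ ω u := funext hrun
      rw [this]
      exact (measurable_of_countable _).comp (by fun_prop)
    have hm2 : Measurable fun ω : ℕ → Fin n → NodeChoice n ↦ ω t := measurable_pi_apply t
    have hmap := (indepFun_iff_map_prod_eq_prod_map_map hm1.aemeasurable hm2.aemeasurable).1 h3
    have hev : (law n).map (fun ω ↦ ω t) = Measure.pi fun _ : Fin n ↦ nodeLaw n :=
      Measure.infinitePi_map_eval _ t
    have hmf : Measurable fun p : Coloring n × (Fin n → NodeChoice n) ↦ f (step p.1 p.2) :=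
      measurable_of_countable _
    calc ∫ ω, f (run χ ω (t + 1)) ∂(law n)
        = ∫ p, f (step p.1 p.2) ∂((law n).map fun ω ↦ (run χ ω t, ω t)) := by
          rw [integral_map (hm1.prodMk hm2).aemeasurable hmf.aestronglyMeasurable]
          rfl
      _ = ∫ χ', avg f χ' ∂((law n).map fun ω ↦ run χ ω t) := by
          have : IsProbabilityMeasure ((law n).map fun ω ↦ run χ ω t) :=
            Measure.isProbabilityMeasure_map hm1.aemeasurable
          rw [hmap, hev, integral_prod _ .of_finite]
          simp only [integral_pi_nodeLaw]
          rfl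
      _ = ∫ ω, avg f (run χ ω t) ∂(law n) :=
          integral_map hm1.aemeasurable (measurable_of_countable _).aestronglyMeasurable

end

/-! ### One round: first moments and fluctuations -/

/-- The size-biased variance `∑ i, α i * (α i - γ) ^ 2` of the color fractions, where `γ` is
their size-biased mean `agree χ`. -/
noncomputable def spread {n : ℕ} (χ : Coloring n) : ℝ := ∑ i, frac χ i * (frac χ i - agree χ) ^ 2

/-- The probability that two given nodes agree after the next round. -/
noncomputable def nextAgree {n : ℕ} (χ : Coloring n) : ℝ := ∑ i, adoptProb χ i ^ 2

/-- The deviation of the fraction of color `i` after a round from its expectation. -/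
noncomputable def dev {n : ℕ} (χ : Coloring n) (s : Fin n → NodeChoice n) (i : Fin n) : ℝ :=
  frac (step χ s) i - adoptProb χ i

section

variable {n : ℕ} (χ : Coloring n)

lemma agree_nonneg : 0 ≤ agree χ := sum_nonneg fun _ _ ↦ sq_nonneg _

lemma spread_nonneg : 0 ≤ spread χ :=
  sum_nonneg fun i _ ↦ mul_nonneg (frac_nonneg χ i) (sq_nonneg _)

lemma nextAgree_nonneg : 0 ≤ nextAgree χ := sum_nonneg fun _ _ ↦ sq_nonneg _

lemma agree_step (s : Fin n → NodeChoice n) : agree (step χ s) =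
    nextAgree χ + 2 * ∑ i, adoptProb χ i * dev χ s i + ∑ i, dev χ s i ^ 2 := by
  rw [agree, nextAgree, mul_sum, ← sum_add_distrib, ← sum_add_distrib]
  exact sum_congr rfl fun i _ ↦ by rw [dev]; ring

/-- The indicator that a node adopts color `i`, centred. -/
noncomputable def centredInd (i : Fin n) (a : NodeChoice n) : ℝ :=
  (if nodeColor χ a = i then 1 else 0) - adoptProb χ i

lemma sum_centredInd_sq (a : NodeChoice n) : ∑ i, centredInd χ i a ^ 2 =
    1 - 2 * adoptProb χ (nodeColor χ a) + nextAgree χ := by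
  have h : ∀ i, centredInd χ i a ^ 2 =
      (if nodeColor χ a = i then 1 - 2 * adoptProb χ i else 0) + adoptProb χ i ^ 2 := by
    intro i; rw [centredInd]; split_ifs <;> ring
  simp only [h, sum_add_distrib, sum_ite_eq, mem_univ, if_true]
  rw [nextAgree]

variable [NeZero n]

lemma natCast_pos : (0 : ℝ) < n := Nat.cast_pos.2 (NeZero.pos n)

lemma agree_le_one : agree χ ≤ 1 := by
  rw [← sum_frac χ, agree]
  exact sum_le_sum fun i _ ↦ by nlinarith [frac_nonneg χ i, frac_le_one χ i]

lemma sum_adoptProb : ∑ i, adoptProb χ i = 1 := by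
  have : ∀ i, adoptProb χ i = frac χ i * (1 - agree χ) + frac χ i ^ 2 := fun i ↦ by
    rw [adoptProb]; ring
  simp only [this, sum_add_distrib, ← sum_mul, sum_frac]
  rw [← agree]; ring

lemma adoptProb_nonneg (i : Fin n) : 0 ≤ adoptProb χ i :=
  mul_nonneg (frac_nonneg χ i) (by linarith [frac_nonneg χ i, agree_le_one χ])

lemma adoptProb_le_one (i : Fin n) : adoptProb χ i ≤ 1 := by
  rw [← sum_adoptProb χ]
  exact single_le_sum (f := adoptProb χ) (fun j _ ↦ adoptProb_nonneg χ j) (mem_univ i)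

lemma nextAgree_le_one : nextAgree χ ≤ 1 := by
  rw [← sum_adoptProb χ, nextAgree]
  exact sum_le_sum fun i _ ↦ by nlinarith [adoptProb_nonneg χ i, adoptProb_le_one χ i]

lemma sum_frac_mul_sub : ∑ i, frac χ i * (frac χ i - agree χ) = 0 := by
  simp only [mul_sub, sum_sub_distrib, ← sum_mul, sum_frac, ← sq]
  rw [← agree]; ring

/-- Selection alone increases the agreement, by at least twice the spread. -/
lemma nextAgree_eq : nextAgree χ =
    agree χ + 2 * spread χ + ∑ i, frac χ i ^ 2 * (frac χ i - agree χ) ^ 2 := by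
  have h : ∀ i, adoptProb χ i ^ 2 = agree χ * frac χ i
      + (1 + 2 * agree χ) * (frac χ i * (frac χ i - agree χ))
      + 2 * (frac χ i * (frac χ i - agree χ) ^ 2)
      + frac χ i ^ 2 * (frac χ i - agree χ) ^ 2 := fun i ↦ by rw [adoptProb]; ring
  simp only [nextAgree, h, sum_add_distrib, ← mul_sum, sum_frac, sum_frac_mul_sub]
  rw [spread]; ring

lemma agree_add_le_nextAgree : agree χ + 2 * spread χ ≤ nextAgree χ := by
  rw [nextAgree_eq]
  linarith [sum_nonneg fun i (_ : i ∈ univ) ↦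
    mul_nonneg (sq_nonneg (frac χ i)) (sq_nonneg (frac χ i - agree χ))]

lemma nextAgree_le_agree_add : nextAgree χ ≤ agree χ + 3 * spread χ := by
  rw [nextAgree_eq, spread]
  have : ∑ i, frac χ i ^ 2 * (frac χ i - agree χ) ^ 2 ≤
      ∑ i, frac χ i * (frac χ i - agree χ) ^ 2 :=
    sum_le_sum fun i _ ↦ by
      refine mul_le_mul_of_nonneg_right ?_ (sq_nonneg _)
      nlinarith [frac_nonneg χ i, frac_le_one χ i]
  linarith

lemma dev_eq (s : Fin n → NodeChoice n) (i : Fin n) :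
    dev χ s i = (∑ v, centredInd χ i (s v)) / n := by
  simp only [dev, frac_step, centredInd, sum_sub_distrib, sum_const, card_univ, Fintype.card_fin,
    nsmul_eq_mul]
  field_simp [(natCast_pos (n := n)).ne']

lemma expect_centredInd (i : Fin n) : 𝔼 a, centredInd χ i a = 0 := by
  simp [centredInd, expect_sub_distrib, expect_nodeColor_eq]

lemma expect_centredInd_sq (i : Fin n) :
    𝔼 a, centredInd χ i a ^ 2 = adoptProb χ i * (1 - adoptProb χ i) := by
  have h : ∀ a, centredInd χ i a ^ 2 =
      (1 - 2 * adoptProb χ i) * (if nodeColor χ a = i then 1 else 0) + adoptProb χ i ^ 2 := by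
    intro a; rw [centredInd]; split_ifs <;> ring
  simp only [h, expect_add_distrib, ← mul_expect, expect_nodeColor_eq, Fintype.expect_const]
  ring

lemma expect_centredInd_cube (i : Fin n) : 𝔼 a, centredInd χ i a ^ 3 =
    adoptProb χ i * (1 - adoptProb χ i) * (1 - 2 * adoptProb χ i) := by
  have h : ∀ a, centredInd χ i a ^ 3 =
      (1 - 3 * adoptProb χ i + 3 * adoptProb χ i ^ 2) * (if nodeColor χ a = i then 1 else 0)
        - adoptProb χ i ^ 3 := by
    intro a; rw [centredInd]; split_ifs <;> ring
  simp only [h, expect_sub_distrib, ← mul_expect, expect_nodeColor_eq, Fintype.expect_const]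
  ring

lemma expect_dev (i : Fin n) : 𝔼 s, dev χ s i = 0 := by
  simp only [dev_eq, ← expect_div, expect_sum_eq_zero (expect_centredInd χ i), zero_div]

lemma expect_dev_sq (i : Fin n) :
    𝔼 s, dev χ s i ^ 2 = adoptProb χ i * (1 - adoptProb χ i) / n := by
  have := (natCast_pos (n := n)).ne'
  simp only [dev_eq, div_pow, ← expect_div, expect_sum_sq (expect_centredInd χ i),
    expect_centredInd_sq]
  field_simp

lemma expect_dev_cube (i : Fin n) : 𝔼 s, dev χ s i ^ 3 =
    adoptProb χ i * (1 - adoptProb χ i) * (1 - 2 * adoptProb χ i) / (n : ℝ) ^ 2 := by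
  have := (natCast_pos (n := n)).ne'
  simp only [dev_eq, div_pow, ← expect_div, expect_sum_cube (expect_centredInd χ i),
    expect_centredInd_cube]
  field_simp

lemma expect_frac_step (i : Fin n) : 𝔼 s, frac (step χ s) i = adoptProb χ i := by
  have h := expect_dev χ i
  simp only [dev, expect_sub_distrib, Fintype.expect_const] at h
  linarith

lemma expect_sum_dev_sq : 𝔼 s, ∑ i, dev χ s i ^ 2 = (1 - nextAgree χ) / n := by
  simp only [expect_sum_comm, expect_dev_sq, ← sum_div, mul_sub, mul_one, sum_sub_distrib,
    sum_adoptProb, ← sq]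
  rw [nextAgree]

lemma expect_sum_dev_sq_sq :
    𝔼 s, (∑ i, dev χ s i ^ 2) ^ 2 ≤ 5 * (1 - nextAgree χ) / (n : ℝ) ^ 2 := by
  have hn := natCast_pos (n := n)
  have hv : 𝔼 a, ∑ i, centredInd χ i a ^ 2 = 1 - nextAgree χ := by
    simp only [expect_sum_comm, expect_centredInd_sq, mul_sub, mul_one, sum_sub_distrib,
      sum_adoptProb, ← sq]
    rw [nextAgree]
  have h := expect_sum_sum_sq_sq (h := centredInd χ) (expect_centredInd χ)
    (fun a ↦ by
      rw [sum_centredInd_sq]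
      linarith [adoptProb_nonneg χ (nodeColor χ a), nextAgree_le_one χ])
    (by rw [hv]; linarith [nextAgree_nonneg χ]) n
  rw [hv] at h
  simp only [dev_eq, div_pow, ← sum_div, ← expect_div]
  rw [div_le_div_iff₀ (by positivity) (by positivity)]
  nlinarith [mul_le_mul_of_nonneg_right h (sq_nonneg (n : ℝ))]

lemma expect_sum_mul_dev : 𝔼 s, ∑ i, adoptProb χ i * dev χ s i = 0 := by
  simp only [expect_sum_comm, ← mul_expect, expect_dev, mul_zero, sum_const_zero]

/-- The linear part of the fluctuation of the agreement is controlled by the spread. -/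
lemma expect_sum_mul_dev_sq :
    𝔼 s, (∑ i, adoptProb χ i * dev χ s i) ^ 2 ≤ 8 * spread χ / n := by
  have hn := natCast_pos (n := n)
  let g : NodeChoice n → ℝ := fun a ↦ adoptProb χ (nodeColor χ a) - nextAgree χ
  have hg : 𝔼 a, g a = 0 := by
    simp only [g, expect_sub_distrib, expect_nodeColor, Fintype.expect_const, ← sq]
    rw [nextAgree, sub_self]
  have hlin : ∀ s : Fin n → NodeChoice n,
      ∑ i, adoptProb χ i * dev χ s i = (∑ v, g (s v)) / n := by
    intro s
    simp only [dev_eq, mul_div_assoc', ← sum_div, mul_sum]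
    rw [sum_comm]
    congr 1
    refine sum_congr rfl fun v _ ↦ ?_
    simp only [centredInd, mul_sub, sum_sub_distrib, mul_ite, mul_one, mul_zero, sum_ite_eq,
      mem_univ, if_true, g, ← sq]
    rw [nextAgree]
  -- The variance of `g` is at most its second moment about `agree χ`.
  have hvar : 𝔼 a, g a ^ 2 ≤ 8 * spread χ := by
    calc 𝔼 a, g a ^ 2 ≤ 𝔼 a, g a ^ 2 + (nextAgree χ - agree χ) ^ 2 := by
          linarith [sq_nonneg (nextAgree χ - agree χ)]
      _ = 𝔼 a, (adoptProb χ (nodeColor χ a) - agree χ) ^ 2 := by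
          have : ∀ a, (adoptProb χ (nodeColor χ a) - agree χ) ^ 2 =
              g a ^ 2 + 2 * (nextAgree χ - agree χ) * g a + (nextAgree χ - agree χ) ^ 2 :=
            fun a ↦ by simp only [g]; ring
          simp only [this, expect_add_distrib, ← mul_expect, hg, Fintype.expect_const]
          ring
      _ = ∑ i, adoptProb χ i * (adoptProb χ i - agree χ) ^ 2 :=
          expect_nodeColor χ fun i ↦ (adoptProb χ i - agree χ) ^ 2
      _ ≤ 8 * spread χ := by
          rw [spread, mul_sum]
          refine sum_le_sum fun i _ ↦ ?_
          have e : adoptProb χ i - agree χ = (frac χ i - agree χ) * (1 + frac χ i) := by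
            rw [adoptProb]; ring
          have h0 := frac_nonneg χ i
          have h1 := frac_le_one χ i
          have h2 : adoptProb χ i ≤ 2 * frac χ i := by
            rw [adoptProb]; nlinarith [agree_nonneg χ]
          rw [e, mul_pow]
          calc adoptProb χ i * ((frac χ i - agree χ) ^ 2 * (1 + frac χ i) ^ 2)
              ≤ 2 * frac χ i * ((frac χ i - agree χ) ^ 2 * 4) := by
                gcongr
                nlinarith
            _ = 8 * (frac χ i * (frac χ i - agree χ) ^ 2) := by ring
  simp only [hlin, div_pow, ← expect_div, expect_sum_sq hg]
  rw [div_le_div_iff₀ (by positivity) hn]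
  nlinarith [mul_le_mul_of_nonneg_right hvar (sq_nonneg (n : ℝ))]

end

/-! ### Surviving colors -/

/-- The set of colors that are supported by some node. -/
def colors {n : ℕ} (χ : Coloring n) : Finset (Fin n) := univ.image χ

section

variable {n : ℕ} {χ : Coloring n}

lemma colors_step_subset (χ : Coloring n) (s : Fin n → NodeChoice n) :
    colors (step χ s) ⊆ colors χ := by
  intro i hi
  obtain ⟨v, -, rfl⟩ := mem_image.1 hi
  simp only [step, adopt, colors, mem_image, mem_univ, true_and]
  split_ifs <;> exact ⟨_, rfl⟩

lemma frac_eq_zero {i : Fin n} (hi : i ∉ colors χ) : frac χ i = 0 := by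
  refine expect_eq_zero fun v _ ↦ if_neg fun h ↦ hi ?_
  exact mem_image.2 ⟨v, mem_univ v, h⟩

lemma sum_colors_eq {f : Fin n → ℝ} (hf : ∀ i, frac χ i = 0 → f i = 0) :
    ∑ i ∈ colors χ, f i = ∑ i, f i :=
  sum_subset (subset_univ _) fun i _ hi ↦ hf i (frac_eq_zero hi)

lemma one_le_mul_frac {i : Fin n} (hi : i ∈ colors χ) : 1 ≤ n * frac χ i := by
  obtain ⟨v, -, rfl⟩ := mem_image.1 hi
  have h := Fintype.card_mul_expect fun w ↦ if χ w = χ v then (1 : ℝ) else 0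
  rw [Fintype.card_fin] at h
  rw [frac, h]
  calc (1 : ℝ) = if χ v = χ v then 1 else 0 := by simp
    _ ≤ _ := single_le_sum (f := fun w ↦ if χ w = χ v then (1 : ℝ) else 0)
        (fun w _ ↦ by split_ifs <;> norm_num) (mem_univ v)

lemma sum_colors_frac_sq (χ : Coloring n) : ∑ i ∈ colors χ, frac χ i ^ 2 = agree χ :=
  sum_colors_eq fun i h ↦ by rw [h]; norm_num

variable [NeZero n]

lemma colors_nonempty (χ : Coloring n) : (colors χ).Nonempty := univ_nonempty.image χ

lemma isConsensus_iff : IsConsensus χ ↔ #(colors χ) ≤ 1 := by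
  rw [card_le_one]
  constructor
  · rintro ⟨c, hc⟩ a ha b hb
    obtain ⟨v, -, rfl⟩ := mem_image.1 ha
    obtain ⟨w, -, rfl⟩ := mem_image.1 hb
    rw [hc, hc]
  · exact fun h ↦ ⟨χ 0, fun v ↦ h _ (mem_image_of_mem χ (mem_univ v)) _
      (mem_image_of_mem χ (mem_univ 0))⟩

lemma sum_colors_frac (χ : Coloring n) : ∑ i ∈ colors χ, frac χ i = 1 := by
  rw [sum_colors_eq fun _ h ↦ h, sum_frac]

lemma sum_colors_frac_sub_sq (χ : Coloring n) (c : ℝ) :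
    ∑ i ∈ colors χ, (frac χ i - c) ^ 2 = agree χ - 2 * c + #(colors χ) * c ^ 2 := by
  have : ∀ i, (frac χ i - c) ^ 2 = frac χ i ^ 2 - 2 * c * frac χ i + c ^ 2 := fun i ↦ by ring
  simp only [this, sum_add_distrib, sum_sub_distrib, ← mul_sum, sum_colors_frac,
    sum_colors_frac_sq, sum_const, nsmul_eq_mul, mul_one]

lemma inv_card_le_agree {k : ℕ} (hk : #(colors χ) ≤ k) : 1 / (k : ℝ) ≤ agree χ := by
  have hc : (0 : ℝ) < #(colors χ) := Nat.cast_pos.2 (colors_nonempty χ).card_pos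
  have h := sum_colors_frac_sub_sq χ (1 / #(colors χ))
  have h0 : 0 ≤ ∑ i ∈ colors χ, (frac χ i - 1 / #(colors χ)) ^ 2 :=
    sum_nonneg fun _ _ ↦ sq_nonneg _
  have e : (#(colors χ) : ℝ) * (1 / #(colors χ)) ^ 2 = 1 / #(colors χ) := by field_simp
  rw [h, e] at h0
  have : 1 / (k : ℝ) ≤ 1 / #(colors χ) := one_div_le_one_div_of_le hc (Nat.cast_le.2 hk)
  linarith

lemma spread_le {k : ℕ} (hk : #(colors χ) = k) : spread χ ≤ agree χ - 1 / k := by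
  have hc : (0 : ℝ) < k := hk ▸ Nat.cast_pos.2 (colors_nonempty χ).card_pos
  have h1 : spread χ ≤ ∑ i, frac χ i * (frac χ i - 1 / k) ^ 2 := by
    have : ∀ i, frac χ i * (frac χ i - 1 / k) ^ 2 = frac χ i * (frac χ i - agree χ) ^ 2
        + 2 * (agree χ - 1 / k) * (frac χ i * (frac χ i - agree χ))
        + (agree χ - 1 / k) ^ 2 * frac χ i := fun i ↦ by ring
    simp only [this, sum_add_distrib, ← mul_sum, sum_frac_mul_sub, sum_frac]
    rw [spread]
    linarith [sq_nonneg (agree χ - 1 / k)]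
  have h2 : ∑ i, frac χ i * (frac χ i - 1 / k) ^ 2 ≤
      ∑ i ∈ colors χ, (frac χ i - 1 / k) ^ 2 := by
    rw [← sum_colors_eq fun i h ↦ by rw [h, zero_mul]]
    exact sum_le_sum fun i _ ↦ mul_le_of_le_one_left (sq_nonneg _) (frac_le_one χ i)
  rw [sum_colors_frac_sub_sq, hk] at h2
  have e : (k : ℝ) * (1 / k) ^ 2 = 1 / k := by field_simp
  rw [e] at h2
  linarith

/-- If every surviving color has fraction at least `c`, then selection is felt: the spread is at
least `c` times the excess of the agreement over its minimal value. -/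
lemma le_spread {k : ℕ} (hk : #(colors χ) = k) {c : ℝ} (hc : 0 ≤ c)
    (h : ∀ i ∈ colors χ, c ≤ frac χ i) : c * (agree χ - 1 / k) ≤ spread χ := by
  have hk0 : (0 : ℝ) < k := hk ▸ Nat.cast_pos.2 (colors_nonempty χ).card_pos
  have h1 : c * ∑ i ∈ colors χ, (frac χ i - agree χ) ^ 2 ≤ spread χ := by
    rw [spread, ← sum_colors_eq fun i h ↦ by rw [h, zero_mul], mul_sum]
    exact sum_le_sum fun i hi ↦ mul_le_mul_of_nonneg_right (h i hi) (sq_nonneg _)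
  rw [sum_colors_frac_sub_sq, hk] at h1
  have h2 := inv_card_le_agree hk.le
  have h3 : agree χ - 1 / k ≤ agree χ - 2 * agree χ + k * agree χ ^ 2 := by
    have h4 : 1 ≤ k * agree χ := by rwa [div_le_iff₀' hk0] at h2
    have e : (agree χ - 1 / k) * (k * agree χ) = agree χ - 2 * agree χ + k * agree χ ^ 2 := by
      field_simp; ring
    rw [← e]
    exact le_mul_of_one_le_right (by linarith) h4
  exact (mul_le_mul_of_nonneg_left h3 hc).trans h1

end

/-! ### Growth of the agreement -/

lemma log_ge_quadratic {n : ℕ} [NeZero n] {x : ℝ} (hx : 1 / (n : ℝ) ≤ x) :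
    (x - 1) - (2 + 4 * Real.log n) * (x - 1) ^ 2 ≤ Real.log x := by
  have hn := natCast_pos (n := n)
  have hx0 : 0 < x := lt_of_lt_of_le (by positivity) hx
  have hl : 0 ≤ Real.log n := Real.log_nonneg (Nat.one_le_cast.2 (NeZero.one_le))
  rcases le_total (1 / 2) x with h | h
  · have h1 := Real.one_sub_inv_le_log_of_pos hx0
    have h2 : 1 - x⁻¹ = (x - 1) - (x - 1) ^ 2 * x⁻¹ := by field_simp; ring
    have h3 : x⁻¹ ≤ 2 := by
      rw [inv_le_comm₀ hx0 (by norm_num)]; linarith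
    nlinarith [sq_nonneg (x - 1), mul_nonneg hl (sq_nonneg (x - 1)),
      mul_le_mul_of_nonneg_left h3 (sq_nonneg (x - 1))]
  · have h1 : -Real.log n ≤ Real.log x := by
      rw [← Real.log_inv, ← one_div]
      exact Real.log_le_log (by positivity) hx
    have h2 : 1 / 4 ≤ (x - 1) ^ 2 := by nlinarith
    nlinarith [mul_le_mul_of_nonneg_left h2 hl, sq_nonneg (x - 1)]

section

variable {n : ℕ} [NeZero n] {χ : Coloring n}

/-- The logarithm of the excess of the agreement over its minimal value, shifted by `b`, is a
submartingale; the two gains are due to selection and to sampling noise. -/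
lemma log_agree_drift {k : ℕ} (hk : #(colors χ) = k) {b : ℝ} (hb1 : b ≤ 1)
    (hb : 192 * (2 + 4 * Real.log n) ≤ n * b) :
    Real.log (agree χ - 1 / k + b) + spread χ / (3 * (agree χ - 1 / k + b))
        + (1 - nextAgree χ) / (2 * n * (nextAgree χ - 1 / k + b))
      ≤ avg (fun χ' ↦ Real.log (agree χ' - 1 / k + b)) χ := by
  have hn := natCast_pos (n := n)
  have hl : 0 ≤ Real.log n := Real.log_nonneg (Nat.one_le_cast.2 (NeZero.one_le))
  set L : ℝ := 2 + 4 * Real.log n with hL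
  have hL2 : 2 ≤ L := by linarith
  have hb0 : 0 < b := by
    by_contra h
    nlinarith
  have hR := inv_card_le_agree hk.le
  have hk0 : (0 : ℝ) < 1 / k :=
    one_div_pos.2 (hk ▸ Nat.cast_pos.2 (colors_nonempty χ).card_pos)
  have hV := spread_nonneg χ
  have hVR := spread_le hk
  have hP := agree_add_le_nextAgree χ
  have hP1 := nextAgree_le_one χ
  set V := spread χ
  set W := agree χ - 1 / k + b with hW
  set Q := nextAgree χ - 1 / k + b with hQ
  set v := 1 - nextAgree χ with hv
  have hWb : b ≤ W := by linarith
  have hQW : W + 2 * V ≤ Q := by linarith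
  have hW0 : 0 < W := by linarith
  have hQ0 : 0 < Q := by linarith
  have hv0 : 0 ≤ v := by linarith
  let A : (Fin n → NodeChoice n) → ℝ := fun s ↦ ∑ i, adoptProb χ i * dev χ s i
  let B : (Fin n → NodeChoice n) → ℝ := fun s ↦ ∑ i, dev χ s i ^ 2
  -- Compare with the value `Q` that the shifted excess would have without sampling noise.
  have pt : ∀ s, Real.log Q + (2 / Q) * A s + (1 / Q) * B s - (8 * L / Q ^ 2) * A s ^ 2
      - (2 * L / Q ^ 2) * B s ^ 2 ≤ Real.log (agree (step χ s) - 1 / k + b) := by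
    intro s
    have hW' : agree (step χ s) - 1 / k + b = Q + 2 * A s + B s := by
      rw [agree_step]; ring
    have hb' : b ≤ Q + 2 * A s + B s := by
      rw [← hW']
      linarith [inv_card_le_agree ((card_le_card (colors_step_subset χ s)).trans hk.le)]
    rw [hW']
    have hx : 1 / (n : ℝ) ≤ (Q + 2 * A s + B s) / Q := by
      rw [div_le_div_iff₀ hn hQ0]
      nlinarith
    have h := log_ge_quadratic hx
    rw [Real.log_div (by linarith) hQ0.ne'] at h
    have e : (Q + 2 * A s + B s) / Q - 1 = (2 * A s + B s) / Q := by
      field_simp; ring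
    rw [e, ← hL] at h
    have h2 : L * ((2 * A s + B s) / Q) ^ 2 ≤
        (8 * L / Q ^ 2) * A s ^ 2 + (2 * L / Q ^ 2) * B s ^ 2 := by
      have : (8 * L / Q ^ 2) * A s ^ 2 + (2 * L / Q ^ 2) * B s ^ 2
          - L * ((2 * A s + B s) / Q) ^ 2 = L * ((2 * A s - B s) / Q) ^ 2 := by
        field_simp; ring
      have : 0 ≤ L * ((2 * A s - B s) / Q) ^ 2 := by positivity
      linarith
    have e2 : (2 * A s + B s) / Q = (2 / Q) * A s + (1 / Q) * B s := by ring
    linarith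
  have hE := expect_mono pt
  simp only [expect_sub_distrib, expect_add_distrib, ← mul_expect, Fintype.expect_const] at hE
  have hA1 : 𝔼 s, A s = 0 := expect_sum_mul_dev χ
  have hA2 : 𝔼 s, A s ^ 2 ≤ 8 * V / n := expect_sum_mul_dev_sq χ
  have hB1 : 𝔼 s, B s = v / n := expect_sum_dev_sq χ
  have hB2 : 𝔼 s, B s ^ 2 ≤ 5 * v / (n : ℝ) ^ 2 := expect_sum_dev_sq_sq χ
  rw [hA1, hB1] at hE
  refine le_trans ?_ hE
  have hlog : 2 * V / (3 * W) ≤ Real.log Q - Real.log W := by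
    have h1 := Real.one_sub_inv_le_log_of_pos (div_pos hQ0 hW0)
    rw [Real.log_div hQ0.ne' hW0.ne', inv_div] at h1
    refine le_trans ?_ h1
    have h2 : W / Q ≤ W / (W + 2 * V) := div_le_div_of_nonneg_left hW0.le (by linarith) hQW
    have h3 : 1 - W / (W + 2 * V) = 2 * V / (W + 2 * V) := by
      field_simp; ring
    have h4 : 2 * V / (3 * W) ≤ 2 * V / (W + 2 * V) :=
      div_le_div_of_nonneg_left (by linarith) (by linarith) (by linarith)
    linarith
  have hAfin : (8 * L / Q ^ 2) * 𝔼 s, A s ^ 2 ≤ V / (3 * W) := by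
    calc (8 * L / Q ^ 2) * 𝔼 s, A s ^ 2 ≤ (8 * L / Q ^ 2) * (8 * V / n) := by gcongr
      _ = V * (64 * L) / (Q * Q * n) := by field_simp; ring
      _ ≤ V * (64 * L) / (W * b * n) := by
          gcongr <;> linarith
      _ ≤ V * (n * b / 3) / (W * b * n) := by
          gcongr; linarith
      _ = V / (3 * W) := by field_simp
  have hBfin : (2 * L / Q ^ 2) * 𝔼 s, B s ^ 2 ≤ v / (2 * n * Q) := by
    calc (2 * L / Q ^ 2) * 𝔼 s, B s ^ 2 ≤ (2 * L / Q ^ 2) * (5 * v / (n : ℝ) ^ 2) := by gcongr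
      _ = v * (10 * L) / (Q * Q * n ^ 2) := by field_simp; ring
      _ ≤ v * (10 * L) / (Q * b * n ^ 2) := by
          gcongr; linarith
      _ ≤ v * (n * b / 2) / (Q * b * n ^ 2) := by
          gcongr; linarith
      _ = v / (2 * n * Q) := by field_simp
  have e1 : (1 / Q) * (v / n) = v / (2 * n * Q) + v / (2 * n * Q) := by field_simp; ring
  have e2 : 2 * V / (3 * W) = V / (3 * W) + V / (3 * W) := by ring
  linarith

end

/-! ### Losing one of `k` colors -/

section

variable {n : ℕ} [NeZero n] {χ : Coloring n}

/-- The smallest fraction of a surviving color, as long as exactly `k` colors survive, and `0`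
otherwise. With this convention it is at most the fraction of each of `k` fixed colors, no matter
whether all of them survive the next round. -/
noncomputable def minFrac (k : ℕ) (χ : Coloring n) : ℝ :=
  if #(colors χ) = k then (colors χ).inf' (colors_nonempty χ) (frac χ) else 0

lemma minFrac_nonneg (k : ℕ) (χ : Coloring n) : 0 ≤ minFrac k χ := by
  rw [minFrac]
  split_ifs
  · exact (le_inf'_iff _ _).2 fun i _ ↦ frac_nonneg χ i
  · exact le_rfl

lemma minFrac_le_frac {k : ℕ} (hk : #(colors χ) = k) {i : Fin n} (hi : i ∈ colors χ) :
    minFrac k χ ≤ frac χ i := by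
  rw [minFrac, if_pos hk]
  exact inf'_le _ hi

lemma minFrac_le_one (k : ℕ) (χ : Coloring n) : minFrac k χ ≤ 1 := by
  by_cases hk : #(colors χ) = k
  · obtain ⟨i, hi⟩ := colors_nonempty χ
    exact (minFrac_le_frac hk hi).trans (frac_le_one χ i)
  · rw [minFrac, if_neg hk]
    norm_num

lemma minFrac_step_le {k : ℕ} (hk : #(colors χ) = k) {i : Fin n} (hi : i ∈ colors χ)
    (s : Fin n → NodeChoice n) : minFrac k (step χ s) ≤ frac (step χ s) i := by
  by_cases hk' : #(colors (step χ s)) = k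
  · refine minFrac_le_frac hk' ?_
    rwa [eq_of_subset_of_card_le (colors_step_subset χ s) (by rw [hk, hk'])]
  · rw [minFrac, if_neg hk']
    exact frac_nonneg _ _

/-- The logarithm of the smallest fraction is a supermartingale, and decreases by a definite
amount if this fraction is well below its largest possible value `1 / k`. -/
lemma log_minFrac_drift {k : ℕ} (hk : #(colors χ) = k) :
    avg (fun χ' ↦ Real.log (1 + n * minFrac k χ')) χ ≤ Real.log (1 + n * minFrac k χ) ∧
    (minFrac k χ < 3 / (4 * k) → avg (fun χ' ↦ Real.log (1 + n * minFrac k χ')) χ ≤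
      Real.log (1 + n * minFrac k χ) - 1 / (8 * k)) := by
  have hn := natCast_pos (n := n)
  have hk1 : (1 : ℝ) ≤ k := by
    rw [← hk]; exact Nat.one_le_cast.2 (colors_nonempty χ).card_pos
  have hk0 : (0 : ℝ) < k := by linarith
  obtain ⟨m, hm, hmin⟩ := exists_mem_eq_inf' (colors_nonempty χ) (frac χ)
  have hμ : minFrac k χ = frac χ m := by rw [minFrac, if_pos hk, hmin]
  set μ := frac χ m with hμdef
  have hnμ : 1 ≤ n * μ := one_le_mul_frac hm
  have hμ0 : 0 ≤ μ := frac_nonneg χ m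
  have hμk : μ ≤ 1 / k := by
    rw [le_div_iff₀' hk0]
    calc (k : ℝ) * μ = ∑ i ∈ colors χ, μ := by rw [sum_const, hk, nsmul_eq_mul]
      _ ≤ ∑ i ∈ colors χ, frac χ i := sum_le_sum fun i hi ↦ hμ ▸ minFrac_le_frac hk hi
      _ = 1 := sum_colors_frac χ
  have hγ := inv_card_le_agree hk.le
  have hmain : ∀ c : ℝ, 1 + n * adoptProb χ m ≤ c →
      avg (fun χ' ↦ Real.log (1 + n * minFrac k χ')) χ ≤ Real.log c := by
    intro c hc
    have h1 : ∀ s, 0 < 1 + n * frac (step χ s) m := fun s ↦ by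
      have := frac_nonneg (step χ s) m
      positivity
    refine le_trans (expect_mono fun s ↦ ?_) (expect_log_le h1 (c := c) ?_)
    · refine Real.log_le_log ?_ ?_
      · have := minFrac_nonneg k (step χ s)
        positivity
      · gcongr
        exact minFrac_step_le hk hm s
    · rwa [expect_add_distrib, ← mul_expect, expect_frac_step, Fintype.expect_const]
  rw [hμ]
  constructor
  · refine hmain _ ?_
    rw [adoptProb, ← hμdef]
    have : μ * (1 + μ - agree χ) ≤ μ := by nlinarith
    gcongr
  · intro hlt
    have hx : 0 < 1 + n * μ := by linarith
    have hk8 : 1 / (8 * (k : ℝ)) < 1 := by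
      rw [div_lt_one (by positivity)]; linarith
    have h1 := hmain ((1 + n * μ) * (1 - 1 / (8 * k))) (by
      have hp : adoptProb χ m ≤ μ * (1 - 1 / (4 * k)) := by
        rw [adoptProb, ← hμdef]
        refine mul_le_mul_of_nonneg_left ?_ hμ0
        have : 1 / (k : ℝ) = 3 / (4 * k) + 1 / (4 * k) := by field_simp; norm_num
        linarith
      have e : (1 + n * μ) * (1 - 1 / (8 * k)) - (1 + n * (μ * (1 - 1 / (4 * k)))) =
          (n * μ - 1) * (1 / (8 * k)) := by field_simp; ring
      have : 0 ≤ (n * μ - 1) * (1 / (8 * (k : ℝ))) := mul_nonneg (by linarith) (by positivity)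
      have := mul_le_mul_of_nonneg_left hp hn.le
      linarith)
    rw [Real.log_mul hx.ne' (by linarith)] at h1
    have h2 := Real.log_le_sub_one_of_pos (show 0 < 1 - 1 / (8 * (k : ℝ)) by linarith)
    linarith

/-- The potential that measures the progress towards the loss of one of `k` colors. -/
noncomputable def lossPotential (k : ℕ) (b : ℝ) (χ : Coloring n) : ℝ :=
  Real.log 2 - Real.log (agree χ - 1 / k + b) + Real.log (1 + n * minFrac k χ)

lemma lossPotential_nonneg {k : ℕ} (hk : #(colors χ) ≤ k) {b : ℝ} (hb0 : 0 < b) (hb1 : b ≤ 1) :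
    0 ≤ lossPotential k b χ := by
  have h := inv_card_le_agree hk
  have hk0 : (0 : ℝ) ≤ 1 / k := by positivity
  have h1 : Real.log (agree χ - 1 / k + b) ≤ Real.log 2 :=
    Real.log_le_log (by linarith) (by linarith [agree_le_one χ])
  have h2 : 0 ≤ Real.log (1 + n * minFrac k χ) :=
    Real.log_nonneg (by
      have := minFrac_nonneg k χ
      have := natCast_pos (n := n)
      have : 0 ≤ n * minFrac k χ := by positivity
      linarith)
  rw [lossPotential]
  linarith

lemma lossPotential_le {k : ℕ} (hk : #(colors χ) ≤ k) {b : ℝ} (hb : 1 / n ≤ b) :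
    lossPotential k b χ ≤ 2 * (Real.log 2 + Real.log n) := by
  have hn := natCast_pos (n := n)
  have hn1 : (1 : ℝ) ≤ n := Nat.one_le_cast.2 NeZero.one_le
  have h := inv_card_le_agree hk
  have h1 : -Real.log n ≤ Real.log (agree χ - 1 / k + b) := by
    rw [← Real.log_inv, ← one_div]
    exact Real.log_le_log (by positivity) (by linarith)
  have h2 : Real.log (1 + n * minFrac k χ) ≤ Real.log 2 + Real.log n := by
    rw [← Real.log_mul (by norm_num) hn.ne']
    have h0 := minFrac_nonneg k χ
    refine Real.log_le_log (by positivity) ?_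
    nlinarith [minFrac_le_one k χ]
  rw [lossPotential]
  linarith

/-- As long as `k` colors survive, the potential decreases: if the smallest fraction is well
below `1 / k` it tends to shrink further, and otherwise the agreement tends to grow. -/
lemma lossPotential_drift {k : ℕ} (h2k : 2 ≤ k) (hk : #(colors χ) = k) {b : ℝ}
    (hb1 : b ≤ 1 / 20) (hb : n * b = 192 * (2 + 4 * Real.log n)) :
    avg (lossPotential k b) χ ≤ lossPotential k b χ - 1 / (8 * k + 48 * (n * b)) := by
  have hn := natCast_pos (n := n)
  have hl : 0 ≤ Real.log n := Real.log_nonneg (Nat.one_le_cast.2 (NeZero.one_le))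
  have hb0 : 0 < b := by
    by_contra h
    nlinarith
  have hk2 : (2 : ℝ) ≤ k := by exact_mod_cast h2k
  have hk0 : (0 : ℝ) < k := by linarith
  have hnb : 0 < n * b := by positivity
  have hR := inv_card_le_agree hk.le
  have hVR := spread_le hk
  have hV := spread_nonneg χ
  have hQ := agree_add_le_nextAgree χ
  have hQ' := nextAgree_le_agree_add χ
  have hP1 := nextAgree_le_one χ
  have hlog := log_agree_drift hk (by linarith) hb.ge
  obtain ⟨hμ, hμ'⟩ := log_minFrac_drift hk
  have hsplit : avg (lossPotential k b) χ = Real.log 2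
      - avg (fun χ' ↦ Real.log (agree χ' - 1 / k + b)) χ
      + avg (fun χ' ↦ Real.log (1 + n * minFrac k χ')) χ := by
    simp only [avg, lossPotential, expect_add_distrib, expect_sub_distrib, Fintype.expect_const]
  have hW0 : 0 < agree χ - 1 / k + b := by linarith
  have hQ0 : 0 < nextAgree χ - 1 / k + b := by linarith
  have hg1 : 0 ≤ spread χ / (3 * (agree χ - 1 / k + b)) := by positivity
  have hg2 : 0 ≤ (1 - nextAgree χ) / (2 * n * (nextAgree χ - 1 / k + b)) :=
    div_nonneg (by linarith) (by positivity)
  have hd1 : 1 / (8 * k + 48 * (n * b)) ≤ 1 / (8 * k) :=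
    one_div_le_one_div_of_le (by positivity) (by linarith)
  have hd2 : 1 / (8 * k + 48 * (n * b)) ≤ 1 / (48 * (n * b)) :=
    one_div_le_one_div_of_le (by positivity) (by linarith)
  rw [hsplit, lossPotential]
  rcases lt_or_ge (minFrac k χ) (3 / (4 * k)) with h | h
  · have := hμ' h
    linarith
  have hs := le_spread hk (c := 3 / (4 * k)) (by positivity)
    fun i hi ↦ h.trans (minFrac_le_frac hk hi)
  rcases le_total b (agree χ - 1 / k) with hbR | hbR
  · -- Selection dominates.
    have : 1 / (8 * k) ≤ spread χ / (3 * (agree χ - 1 / k + b)) := by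
      rw [div_le_div_iff₀ (by positivity) (by positivity)]
      have e : 3 / (4 * k) * (agree χ - 1 / k) * (8 * k) = 6 * (agree χ - 1 / k) := by
        field_simp; ring
      have := mul_le_mul_of_nonneg_right hs (show (0 : ℝ) ≤ 8 * k by positivity)
      linarith
    linarith
  · -- Sampling noise dominates.
    have hk12 : 1 / (k : ℝ) ≤ 1 / 2 := one_div_le_one_div_of_le (by norm_num) hk2
    have : 1 / (48 * (n * b)) ≤
        (1 - nextAgree χ) / (2 * n * (nextAgree χ - 1 / k + b)) := by
      have h1 : nextAgree χ - 1 / k + b ≤ 5 * b := by linarith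
      have h2 : 3 / 10 ≤ 1 - nextAgree χ := by linarith
      calc 1 / (48 * (n * b)) ≤ (3 / 10) / (2 * n * (5 * b)) := by
            rw [div_le_div_iff₀ (by positivity) (by positivity)]; nlinarith
        _ ≤ _ := by gcongr
    linarith

end

/-! ### Entropy and the number of colors -/

/-- A cubic minorant of `u * log u`, touching it at `1`. Its expectation at a binomial variable
divided by its mean involves only the first three moments. -/
lemma cubic_le_mul_log {u : ℝ} (hu : 0 ≤ u) :
    (u - 1) + 5 / 36 * (u - 1) ^ 2 - 1 / 72 * (u - 1) ^ 3 ≤ u * Real.log u := by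
  obtain ⟨w, hw, rfl⟩ : ∃ w : ℝ, 0 ≤ w ∧ w ^ 2 = u := ⟨√u, Real.sqrt_nonneg u, Real.sq_sqrt hu⟩
  rcases hw.eq_or_lt with rfl | hw0
  · norm_num
  have h1 : 2 * w ^ 2 - 2 * w ≤ w ^ 2 * Real.log (w ^ 2) := by
    rw [Real.log_pow]
    have h := mul_le_mul_of_nonneg_left (Real.one_sub_inv_le_log_of_pos hw0) (sq_nonneg w)
    have e : w ^ 2 * (1 - w⁻¹) = w ^ 2 - w := by field_simp
    push_cast
    linarith
  have h2 : 0 ≤ w ^ 4 + 2 * w ^ 3 - 10 * w ^ 2 - 22 * w + 61 := by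
    nlinarith [sq_nonneg (w ^ 2 + w - 13 / 2), sq_nonneg (w - 2), sq_nonneg (w ^ 2 - 4),
      mul_nonneg hw (sq_nonneg (w - 2))]
  have h3 : 2 * w ^ 2 - 2 * w -
      ((w ^ 2 - 1) + 5 / 36 * (w ^ 2 - 1) ^ 2 - 1 / 72 * (w ^ 2 - 1) ^ 3) =
      (w - 1) ^ 2 * (w ^ 4 + 2 * w ^ 3 - 10 * w ^ 2 - 22 * w + 61) / 72 := by ring
  have h4 := mul_nonneg (sq_nonneg (w - 1)) h2
  linarith

/-- The Shannon entropy of the color fractions. -/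
noncomputable def entropy {n : ℕ} (χ : Coloring n) : ℝ := ∑ i, Real.negMulLog (frac χ i)

section

variable {n : ℕ} [NeZero n] {χ : Coloring n}

lemma frac_pos {i : Fin n} (hi : i ∈ colors χ) : 0 < frac χ i := by
  have h := one_le_mul_frac hi
  have hn := natCast_pos (n := n)
  by_contra h'
  nlinarith

lemma adoptProb_pos {i : Fin n} (hi : i ∈ colors χ) : 0 < adoptProb χ i :=
  mul_pos (frac_pos hi) (by linarith [frac_pos hi, agree_le_one χ])

lemma entropy_nonneg (χ : Coloring n) : 0 ≤ entropy χ :=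
  sum_nonneg fun i _ ↦ Real.negMulLog_nonneg (frac_nonneg χ i) (frac_le_one χ i)

lemma entropy_le (χ : Coloring n) : entropy χ ≤ Real.log n := by
  have hn := natCast_pos (n := n)
  calc entropy χ = ∑ i ∈ colors χ, Real.negMulLog (frac χ i) :=
        (sum_colors_eq fun i h ↦ by rw [h, Real.negMulLog_zero]).symm
    _ ≤ ∑ i ∈ colors χ, frac χ i * Real.log n := by
        refine sum_le_sum fun i hi ↦ ?_
        have h : -Real.log n ≤ Real.log (frac χ i) := by
          rw [← Real.log_inv]
          exact Real.log_le_log (by positivity) (by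
            rw [inv_le_iff_one_le_mul₀' hn]; exact one_le_mul_frac hi)
        rw [Real.negMulLog]
        nlinarith [frac_nonneg χ i]
    _ = Real.log n := by rw [← sum_mul, sum_colors_frac, one_mul]

/-- Selection alone does not increase the entropy. -/
lemma sum_negMulLog_adoptProb_le (χ : Coloring n) :
    ∑ i ∈ colors χ, Real.negMulLog (adoptProb χ i) ≤ entropy χ := by
  have hγ : 0 < agree χ := lt_of_lt_of_le
    (one_div_pos.2 (Nat.cast_pos.2 (colors_nonempty χ).card_pos)) (inv_card_le_agree le_rfl)
  have hz : ∀ c : ℝ, ∑ i ∈ colors χ, c * (frac χ i * (frac χ i - agree χ)) = 0 := by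
    intro c
    rw [← mul_sum, sum_colors_eq fun i h ↦ by rw [h, zero_mul], sum_frac_mul_sub, mul_zero]
  calc ∑ i ∈ colors χ, Real.negMulLog (adoptProb χ i)
      ≤ ∑ i ∈ colors χ, (Real.negMulLog (frac χ i)
          - (1 + Real.log (agree χ)) * (frac χ i * (frac χ i - agree χ))) := by
        refine sum_le_sum fun i hi ↦ ?_
        have hα := frac_pos hi
        have hp := adoptProb_pos hi
        have h1 := Real.log_le_sub_one_of_pos (div_pos hα hp)
        rw [Real.log_div hα.ne' hp.ne'] at h1
        have h2 := mul_le_mul_of_nonneg_left h1 hp.le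
        have e : adoptProb χ i * (frac χ i / adoptProb χ i - 1) =
            -(frac χ i * (frac χ i - agree χ)) := by
          field_simp; rw [adoptProb]; ring
        -- `log` is increasing, so `log (frac χ i)` and `frac χ i` are positively correlated.
        have h3 : 0 ≤ (Real.log (frac χ i) - Real.log (agree χ)) * (frac χ i - agree χ) := by
          rcases le_total (frac χ i) (agree χ) with h | h
          · exact mul_nonneg_of_nonpos_of_nonpos
              (sub_nonpos.2 (Real.log_le_log hα h)) (sub_nonpos.2 h)
          · exact mul_nonneg (sub_nonneg.2 (Real.log_le_log hγ h)) (sub_nonneg.2 h)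
        have h4 := mul_nonneg hα.le h3
        have h5 : adoptProb χ i * Real.log (frac χ i) = frac χ i * Real.log (frac χ i)
            + frac χ i * (frac χ i - agree χ) * Real.log (frac χ i) := by
          rw [adoptProb]; ring
        rw [Real.negMulLog, Real.negMulLog]
        linarith
    _ = entropy χ := by
        rw [sum_sub_distrib, hz, sub_zero]
        exact sum_colors_eq fun i h ↦ by rw [h, Real.negMulLog_zero]

/-- The entropy contribution of one color: by concavity, sampling noise decreases it, and it does
so by a definite amount if several nodes are expected to adopt the color. -/
lemma expect_negMulLog_frac_step {i : Fin n} (hi : i ∈ colors χ) :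
    𝔼 s, Real.negMulLog (frac (step χ s) i) ≤ Real.negMulLog (adoptProb χ i) ∧
    (1 / 4 ≤ n * adoptProb χ i → 𝔼 s, Real.negMulLog (frac (step χ s) i) ≤
      Real.negMulLog (adoptProb χ i) - (1 - adoptProb χ i) / (12 * n)) := by
  have hn := natCast_pos (n := n)
  have hp := adoptProb_pos hi
  have hp1 := adoptProb_le_one χ i
  have h1 := expect_dev χ i
  have h2 := expect_dev_sq χ i
  have h3 := expect_dev_cube χ i
  set p := adoptProb χ i with hpdef
  have hx : ∀ s, frac (step χ s) i = p + dev χ s i := fun s ↦ by rw [dev]; ring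
  constructor
  · have pt : ∀ s, Real.negMulLog (frac (step χ s) i) ≤
        Real.negMulLog p - (1 + Real.log p) * dev χ s i := by
      intro s
      have h0 := frac_nonneg (step χ s) i
      have e : dev χ s i = frac (step χ s) i - p := by rw [hx]; ring
      rw [e]
      set x := frac (step χ s) i
      rcases h0.eq_or_lt with h0 | h0
      · rw [← h0, Real.negMulLog_zero, Real.negMulLog]
        linarith
      · have h := Real.log_le_sub_one_of_pos (div_pos hp h0)
        rw [Real.log_div hp.ne' h0.ne'] at h
        have h' := mul_le_mul_of_nonneg_left h h0.le
        have e : x * (p / x - 1) = p - x := by field_simp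
        rw [Real.negMulLog, Real.negMulLog]
        linarith
    refine (expect_mono pt).trans_eq ?_
    rw [expect_sub_distrib, ← mul_expect, h1, Fintype.expect_const, mul_zero, sub_zero]
  · intro hnp
    have pt : ∀ s, Real.negMulLog (frac (step χ s) i) ≤
        Real.negMulLog p - (1 + Real.log p) * dev χ s i - 5 / (36 * p) * dev χ s i ^ 2
          + 1 / (72 * p ^ 2) * dev χ s i ^ 3 := by
      intro s
      have h0 := frac_nonneg (step χ s) i
      have e : dev χ s i = frac (step χ s) i - p := by rw [hx]; ring
      rw [e]
      set x := frac (step χ s) i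
      have h := mul_le_mul_of_nonneg_left (cubic_le_mul_log (div_nonneg h0 hp.le)) hp.le
      have e1 : p * (x / p - 1 + 5 / 36 * (x / p - 1) ^ 2 - 1 / 72 * (x / p - 1) ^ 3) =
          (x - p) + 5 / (36 * p) * (x - p) ^ 2 - 1 / (72 * p ^ 2) * (x - p) ^ 3 := by
        field_simp
      have e2 : p * (x / p * Real.log (x / p)) = x * Real.log x - x * Real.log p := by
        rcases h0.eq_or_lt with h0 | h0
        · rw [← h0]; simp
        · rw [Real.log_div h0.ne' hp.ne']; field_simp
      rw [e1, e2] at h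
      rw [Real.negMulLog, Real.negMulLog]
      linarith
    refine (expect_mono pt).trans ?_
    simp only [expect_add_distrib, expect_sub_distrib, ← mul_expect, h1, h2, h3,
      Fintype.expect_const]
    have e1 : 5 / (36 * p) * (p * (1 - p) / n) = 5 / 36 * ((1 - p) / n) := by field_simp
    have e2 : 1 / (72 * p ^ 2) * (p * (1 - p) * (1 - 2 * p) / (n : ℝ) ^ 2) ≤
        1 / 18 * ((1 - p) / n) := by
      have e : 1 / (72 * p ^ 2) * (p * (1 - p) * (1 - 2 * p) / (n : ℝ) ^ 2) =
          (1 - p) / n * ((1 - 2 * p) / (72 * (n * p))) := by field_simp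
      rw [e, mul_comm]
      refine mul_le_mul_of_nonneg_right ?_ (div_nonneg (by linarith) hn.le)
      rw [div_le_div_iff₀ (by positivity) (by norm_num)]
      linarith
    have e3 : (1 - p) / (12 * n) = 1 / 12 * ((1 - p) / n) := by field_simp
    rw [e1, e3]
    linarith

lemma sum_colors_adoptProb (χ : Coloring n) : ∑ i ∈ colors χ, adoptProb χ i = 1 := by
  rw [sum_colors_eq fun i h ↦ by rw [adoptProb, h, zero_mul], sum_adoptProb]

/-- The entropy is a supermartingale; as long as no color is close to winning, its decrease is
proportional to the number of surviving colors. -/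
lemma entropy_drift (χ : Coloring n) : avg entropy χ ≤ entropy χ ∧
    (agree χ ≤ 3 / 4 → avg entropy χ ≤ entropy χ - (#(colors χ) - 1) / (12 * n)) := by
  have hn := natCast_pos (n := n)
  have h : avg entropy χ = ∑ i ∈ colors χ, 𝔼 s, Real.negMulLog (frac (step χ s) i) := by
    rw [← expect_sum_comm]
    refine expect_congr rfl fun s _ ↦ (sum_subset (subset_univ _) fun i _ hi ↦ ?_).symm
    rw [frac_eq_zero fun h ↦ hi (colors_step_subset χ s h), Real.negMulLog_zero]
  rw [h]
  refine ⟨(sum_le_sum fun i hi ↦ (expect_negMulLog_frac_step hi).1).trans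
    (sum_negMulLog_adoptProb_le χ), fun hγ ↦ ?_⟩
  calc ∑ i ∈ colors χ, 𝔼 s, Real.negMulLog (frac (step χ s) i)
      ≤ ∑ i ∈ colors χ,
          (Real.negMulLog (adoptProb χ i) - (1 - adoptProb χ i) / (12 * n)) := by
        refine sum_le_sum fun i hi ↦ (expect_negMulLog_frac_step hi).2 ?_
        have h1 := one_le_mul_frac hi
        have h2 := frac_nonneg χ i
        rw [adoptProb]
        nlinarith [mul_nonneg (sub_nonneg.2 h1) (show 0 ≤ 1 + frac χ i - agree χ by linarith)]
    _ = ∑ i ∈ colors χ, Real.negMulLog (adoptProb χ i) - (#(colors χ) - 1) / (12 * n) := by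
        rw [sum_sub_distrib, ← sum_div, sum_sub_distrib, sum_colors_adoptProb, sum_const,
          nsmul_eq_mul, mul_one]
    _ ≤ _ := sub_le_sub_right (sum_negMulLog_adoptProb_le χ) _

/-! ### The end game of a dominating color -/

lemma one_sub_agree_le_spread (hγ : 3 / 4 ≤ agree χ) : (1 - agree χ) / 8 ≤ spread χ := by
  obtain ⟨m, -, hm⟩ := exists_max_image univ (frac χ) univ_nonempty
  have hγm : agree χ ≤ frac χ m := by
    calc agree χ = ∑ i, frac χ i * frac χ i := by simp only [agree, sq]
      _ ≤ ∑ i, frac χ i * frac χ m := sum_le_sum fun i _ ↦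
          mul_le_mul_of_nonneg_left (hm i (mem_univ i)) (frac_nonneg χ i)
      _ = frac χ m := by rw [← sum_mul, sum_frac, one_mul]
  have hm2 : frac χ m ^ 2 ≤ agree χ :=
    single_le_sum (f := fun i ↦ frac χ i ^ 2) (fun _ _ ↦ sq_nonneg _) (mem_univ m)
  have hsum : frac χ m + ∑ i ∈ univ.erase m, frac χ i = 1 := by
    rw [add_sum_erase _ _ (mem_univ m), sum_frac]
  have h1 : (∑ i ∈ univ.erase m, frac χ i) * (1 / 4) ≤ spread χ := by
    rw [spread, ← add_sum_erase _ _ (mem_univ m), sum_mul]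
    have h0 : 0 ≤ frac χ m * (frac χ m - agree χ) ^ 2 :=
      mul_nonneg (frac_nonneg χ m) (sq_nonneg _)
    have : ∑ i ∈ univ.erase m, frac χ i * (1 / 4) ≤
        ∑ i ∈ univ.erase m, frac χ i * (frac χ i - agree χ) ^ 2 := by
      refine sum_le_sum fun i hi ↦ mul_le_mul_of_nonneg_left ?_ (frac_nonneg χ i)
      have : frac χ i ≤ ∑ i ∈ univ.erase m, frac χ i :=
        single_le_sum (f := frac χ) (fun j _ ↦ frac_nonneg χ j) hi
      nlinarith
    linarith
  nlinarith [frac_le_one χ m]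

lemma one_le_mul_one_sub_agree (h2 : 2 ≤ #(colors χ)) : 1 ≤ n * (1 - agree χ) := by
  have hn := natCast_pos (n := n)
  have h : ∀ i ∈ colors χ, frac χ i * 1 ≤ frac χ i * (n * (1 - frac χ i)) := by
    intro i hi
    refine mul_le_mul_of_nonneg_left ?_ (frac_nonneg χ i)
    obtain ⟨j, hj, hji⟩ := exists_mem_ne (by omega : 1 < #(colors χ)) i
    have : frac χ i + frac χ j ≤ 1 := by
      rw [← sum_frac χ, ← sum_pair hji.symm]
      exact sum_le_sum_of_subset_of_nonneg (subset_univ _) fun i _ _ ↦ frac_nonneg χ i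
    nlinarith [one_le_mul_frac hj]
  have h' := sum_le_sum h
  have e : ∀ i, frac χ i * (n * (1 - frac χ i)) = n * frac χ i - n * frac χ i ^ 2 :=
    fun i ↦ by ring
  simp only [e, mul_one, sum_sub_distrib, ← mul_sum, sum_colors_frac, sum_colors_frac_sq] at h'
  linarith

lemma log_disagree_drift (h2 : 2 ≤ #(colors χ)) :
    avg (fun χ' ↦ Real.log (1 + n * (1 - agree χ'))) χ ≤ Real.log (1 + n * (1 - agree χ)) ∧
    (3 / 4 ≤ agree χ → avg (fun χ' ↦ Real.log (1 + n * (1 - agree χ'))) χ ≤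
      Real.log (1 + n * (1 - agree χ)) - 1 / 8) := by
  have hn := natCast_pos (n := n)
  have hP := agree_add_le_nextAgree χ
  have hV := spread_nonneg χ
  have hmain : ∀ c : ℝ, 1 + n * (1 - nextAgree χ) ≤ c →
      avg (fun χ' ↦ Real.log (1 + n * (1 - agree χ'))) χ ≤ Real.log c := by
    intro c hc
    refine expect_log_le (fun s ↦ ?_) ?_
    · have := mul_nonneg hn.le (sub_nonneg.2 (agree_le_one (step χ s)))
      linarith
    · simp only [agree_step, expect_add_distrib, ← mul_expect, expect_sub_distrib,
        Fintype.expect_const, expect_sum_mul_dev, expect_sum_dev_sq]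
      have : 0 ≤ (1 - nextAgree χ) / n := div_nonneg (by linarith [nextAgree_le_one χ]) hn.le
      have := mul_nonneg hn.le this
      linarith
  have hy := one_le_mul_one_sub_agree h2
  constructor
  · refine hmain _ ?_
    have := mul_le_mul_of_nonneg_left (show 1 - nextAgree χ ≤ 1 - agree χ by linarith) hn.le
    linarith
  · intro hγ
    have hs := one_sub_agree_le_spread hγ
    have h1 := hmain ((1 + n * (1 - agree χ)) * (7 / 8)) (by
      have := mul_le_mul_of_nonneg_left
        (show 1 - nextAgree χ ≤ 3 / 4 * (1 - agree χ) by linarith) hn.le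
      linarith)
    rw [Real.log_mul (by linarith) (by norm_num)] at h1
    have := Real.log_le_sub_one_of_pos (show (0 : ℝ) < 7 / 8 by norm_num)
    linarith

/-! ### Reducing the number of colors to `k` -/

/-- The potential that measures the progress towards a state with at most `k` colors. -/
noncomputable def reductionPotential (k : ℕ) (χ : Coloring n) : ℝ :=
  12 * n / k * entropy χ + 8 * Real.log (1 + n * (1 - agree χ))

lemma reductionPotential_nonneg (k : ℕ) (χ : Coloring n) : 0 ≤ reductionPotential k χ := by
  have := entropy_nonneg χ
  have h := mul_nonneg (natCast_pos (n := n)).le (sub_nonneg.2 (agree_le_one χ))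
  have := Real.log_nonneg (show 1 ≤ 1 + n * (1 - agree χ) by linarith)
  rw [reductionPotential]
  positivity

lemma reductionPotential_le (k : ℕ) (χ : Coloring n) :
    reductionPotential k χ ≤ 12 * n / k * Real.log n + 8 * (Real.log 2 + Real.log n) := by
  have hn := natCast_pos (n := n)
  have hn1 : (1 : ℝ) ≤ n := Nat.one_le_cast.2 NeZero.one_le
  have h0 := mul_nonneg hn.le (sub_nonneg.2 (agree_le_one χ))
  have h1 := mul_nonneg hn.le (agree_nonneg χ)
  have h : Real.log (1 + n * (1 - agree χ)) ≤ Real.log 2 + Real.log n := by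
    rw [← Real.log_mul (by norm_num) hn.ne']
    exact Real.log_le_log (by linarith) (by linarith)
  rw [reductionPotential]
  have := entropy_le χ
  gcongr

/-- If more than `k` colors survive, the potential decreases: through the entropy if no color
dominates, and otherwise because the dominating color takes over. -/
lemma reductionPotential_drift {k : ℕ} (hk : 1 ≤ k) (h : k < #(colors χ)) :
    avg (reductionPotential k) χ ≤ reductionPotential k χ - 1 := by
  have hn := natCast_pos (n := n)
  have hk0 : (0 : ℝ) < k := Nat.cast_pos.2 hk
  obtain ⟨he, he'⟩ := entropy_drift χ
  obtain ⟨hl, hl'⟩ := log_disagree_drift (χ := χ) (by omega)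
  have hsplit : avg (reductionPotential k) χ = 12 * n / k * avg entropy χ
      + 8 * avg (fun χ' ↦ Real.log (1 + n * (1 - agree χ'))) χ := by
    simp only [avg, reductionPotential, expect_add_distrib, ← mul_expect]
  rw [hsplit, reductionPotential]
  have hc : 0 ≤ 12 * (n : ℝ) / k := by positivity
  rcases le_total (agree χ) (3 / 4) with hγ | hγ
  · have h1 := mul_le_mul_of_nonneg_left (he' hγ) hc
    have h2 : 1 ≤ 12 * n / k * (((#(colors χ) : ℝ) - 1) / (12 * n)) := by
      have e : 12 * n / k * (((#(colors χ) : ℝ) - 1) / (12 * n)) = (#(colors χ) - 1) / k := by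
        field_simp
      rw [e, one_le_div hk0]
      have : (k : ℝ) + 1 ≤ #(colors χ) := by exact_mod_cast h
      linarith
    linarith
  · have h1 := mul_le_mul_of_nonneg_left he hc
    have h2 := hl' hγ
    linarith

end

/-! ### From potentials to tail bounds -/

section

variable {n : ℕ}

open Classical in
/-- The indicator of the states that are not yet a consensus. -/
noncomputable def unsettled (χ : Coloring n) : ℝ := if IsConsensus χ then 0 else 1

lemma unsettled_nonneg (χ : Coloring n) : 0 ≤ unsettled χ := by
  rw [unsettled]; split_ifs <;> norm_num

lemma iterate_avg_mono {f g : Coloring n → ℝ} (h : ∀ χ, f χ ≤ g χ) (t : ℕ) (χ : Coloring n) :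
    avg^[t] f χ ≤ avg^[t] g χ := by
  induction t generalizing f g with
  | zero => exact h χ
  | succ t ih => exact ih (avg_mono h)

lemma iterate_avg_const_mul (c : ℝ) (f : Coloring n → ℝ) (t : ℕ) (χ : Coloring n) :
    avg^[t] (fun χ ↦ c * f χ) χ = c * avg^[t] f χ := by
  induction t generalizing f with
  | zero => rfl
  | succ t ih =>
    have h : avg (fun χ ↦ c * f χ) = fun χ ↦ c * avg f χ :=
      funext fun χ ↦ by simp only [avg, ← mul_expect]
    rw [Function.iterate_succ_apply, Function.iterate_succ_apply, ← ih, h]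

lemma iterate_avg_unsettled_le_half_pow {t : ℕ}
    (h : ∀ χ : Coloring n, avg^[t] unsettled χ ≤ 1 / 2 * unsettled χ) (j : ℕ) (χ : Coloring n) :
    avg^[t * j] unsettled χ ≤ (1 / 2) ^ j := by
  suffices h' : avg^[t * j] unsettled χ ≤ (1 / 2) ^ j * unsettled χ by
    refine h'.trans (mul_le_of_le_one_right (by positivity) ?_)
    rw [unsettled]; split_ifs <;> norm_num
  induction j generalizing χ with
  | zero => simp
  | succ j ih =>
    rw [Nat.mul_succ, add_comm, Function.iterate_add_apply]
    refine (iterate_avg_mono ih t χ).trans ?_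
    rw [iterate_avg_const_mul, pow_succ, mul_assoc]
    gcongr
    exact h χ

variable [NeZero n]

lemma avg_const_add_mul (c d : ℝ) (f : Coloring n → ℝ) (χ : Coloring n) :
    avg (fun χ ↦ c + d * f χ) χ = c + d * avg f χ := by
  simp only [avg, expect_add_distrib, ← mul_expect, Fintype.expect_const]

lemma IsConsensus.step {χ : Coloring n} (h : IsConsensus χ) (s : Fin n → NodeChoice n) :
    IsConsensus (step χ s) :=
  isConsensus_iff.2 <| (card_le_card (colors_step_subset χ s)).trans (isConsensus_iff.1 h)

lemma iterate_avg_unsettled_le (t : ℕ) (χ : Coloring n) :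
    avg^[t] unsettled χ ≤ unsettled χ := by
  induction t generalizing χ with
  | zero => exact le_rfl
  | succ t ih =>
    rw [Function.iterate_succ_apply']
    refine (avg_mono ih χ).trans ?_
    by_cases h : IsConsensus χ
    · refine (expect_mono (g := fun _ ↦ 0) fun s ↦ ?_).trans ?_
      · rw [unsettled, if_pos (h.step s)]
      · rw [expect_const_zero]; exact unsettled_nonneg χ
    · refine (expect_mono (g := fun _ ↦ 1) fun s ↦ ?_).trans ?_
      · rw [unsettled]; split_ifs <;> norm_num
      · rw [Fintype.expect_const, unsettled, if_neg h]

/-- Additive drift: a nonnegative potential that decreases by at least `1` in expectation in each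
round before consensus bounds the expected time of consensus. Since the probability of not being
settled decreases over time, this bounds that probability. -/
lemma mul_iterate_avg_unsettled_le {Φ : Coloring n → ℝ} (h0 : ∀ χ, 0 ≤ Φ χ)
    (hΦ : ∀ χ, ¬ IsConsensus χ → avg Φ χ ≤ Φ χ - 1) (t : ℕ) (χ : Coloring n) :
    t * avg^[t] unsettled χ ≤ Φ χ := by
  induction t generalizing χ with
  | zero => simpa using h0 χ
  | succ t ih =>
    have h1 := iterate_avg_unsettled_le (t + 1) χ
    by_cases h : IsConsensus χ
    · rw [unsettled, if_pos h] at h1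
      exact (mul_nonpos_of_nonneg_of_nonpos (by positivity) h1).trans (h0 χ)
    · rw [unsettled, if_neg h] at h1
      have h2 : t * avg^[t + 1] unsettled χ ≤ avg Φ χ := by
        rw [Function.iterate_succ_apply', avg, mul_expect]
        exact expect_mono fun s ↦ ih _
      have h3 := hΦ χ h
      push_cast
      linarith

lemma iterate_avg_unsettled_le_half {Φ : Coloring n → ℝ} (h0 : ∀ χ, 0 ≤ Φ χ)
    (hΦ : ∀ χ, ¬ IsConsensus χ → avg Φ χ ≤ Φ χ - 1) {M : ℝ} (hM : ∀ χ, Φ χ ≤ M) {t : ℕ}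
    (ht0 : 0 < t) (ht : 2 * M ≤ t) (χ : Coloring n) :
    avg^[t] unsettled χ ≤ 1 / 2 * unsettled χ := by
  have ht' : (0 : ℝ) < t := Nat.cast_pos.2 ht0
  by_cases h : IsConsensus χ
  · have h1 := iterate_avg_unsettled_le t χ
    rw [unsettled, if_pos h] at h1 ⊢
    simpa using h1
  · have h1 := (mul_iterate_avg_unsettled_le h0 hΦ t χ).trans (hM χ)
    rw [unsettled, if_neg h, mul_one]
    by_contra! h2
    nlinarith

lemma measureReal_not_isConsensus (χ : Coloring n) (t : ℕ) :
    (law n).real {ω | ¬ IsConsensus (run χ ω t)} = avg^[t] unsettled χ := by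
  have hm : MeasurableSet {ω | ¬ IsConsensus (run χ ω t)} := by
    have hrun : ∀ u, Measurable fun ω ↦ run χ ω u := by
      intro u
      induction u with
      | zero => exact measurable_const
      | succ u ih =>
        exact (measurable_of_countable fun p : Coloring n × (Fin n → NodeChoice n) ↦
          step p.1 p.2).comp (ih.prodMk (measurable_pi_apply u))
    exact hrun t (Set.to_countable {χ | ¬ IsConsensus χ}).measurableSet
  rw [← integral_run, ← integral_indicator_one hm]
  congr 1
  funext ω
  by_cases h : IsConsensus (run χ ω t)
  · rw [unsettled, if_pos h, Set.indicator_of_notMem (by simpa using h)]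
  · rw [unsettled, if_neg h, Set.indicator_of_mem (by simpa using h), Pi.one_apply]

/-- A bounded potential with drift at least `1` yields consensus with high probability: after
twice the bound, the process is settled with probability at least one half, and this is repeated
a logarithmic number of times. -/
lemma one_sub_inv_le_measureReal_isConsensus {Φ : Coloring n → ℝ} (h0 : ∀ χ, 0 ≤ Φ χ)
    (hΦ : ∀ χ, ¬ IsConsensus χ → avg Φ χ ≤ Φ χ - 1) {M : ℝ} (hM : ∀ χ, Φ χ ≤ M)
    (χ : Coloring n) {T : ℝ} (hT : (2 * M + 1) * (2 * Real.log n + 1) ≤ T) :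
    1 - 1 / (n : ℝ) ≤
      (law n).real {ω | ∃ t : ℕ, (t : ℝ) ≤ T ∧ IsConsensus (run χ ω t)} := by
  have hn := natCast_pos (n := n)
  have hl : 0 ≤ Real.log n := Real.log_nonneg (Nat.one_le_cast.2 (NeZero.one_le))
  have hM0 : 0 ≤ M := (h0 χ).trans (hM χ)
  set t := ⌊2 * M⌋₊ + 1 with ht
  set j := ⌈2 * Real.log n⌉₊ with hj
  have ht1 : 2 * M ≤ t := by
    rw [ht]; push_cast; exact (Nat.lt_floor_add_one _).le
  have ht2 : (t : ℝ) ≤ 2 * M + 1 := by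
    rw [ht]; push_cast; linarith [Nat.floor_le (show 0 ≤ 2 * M by linarith)]
  have hj1 : 2 * Real.log n ≤ j := Nat.le_ceil _
  have hj2 : (j : ℝ) ≤ 2 * Real.log n + 1 := (Nat.ceil_lt_add_one (by linarith)).le
  have htj : ((t * j : ℕ) : ℝ) ≤ T := by
    push_cast
    exact (mul_le_mul ht2 hj2 (by positivity) (by linarith)).trans hT
  have h1 := iterate_avg_unsettled_le_half_pow
    (iterate_avg_unsettled_le_half h0 hΦ hM (Nat.succ_pos _) ht1) j χ
  have h2 : (1 / 2 : ℝ) ^ j ≤ 1 / n := by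
    rw [one_div_pow]
    refine one_div_le_one_div_of_le hn ?_
    rw [← Real.log_le_log_iff hn (by positivity), Real.log_pow]
    nlinarith [Real.log_two_gt_d9]
  rw [← measureReal_not_isConsensus] at h1
  have h3 : (law n).real (Set.univ : Set (ℕ → Fin n → NodeChoice n)) ≤
      (law n).real {ω | ∃ t : ℕ, (t : ℝ) ≤ T ∧ IsConsensus (run χ ω t)}
        + (law n).real {ω | ¬ IsConsensus (run χ ω (t * j))} := by
    refine (measureReal_mono ?_).trans (measureReal_union_le _ _)
    intro ω _
    by_cases h : IsConsensus (run χ ω (t * j))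
    · exact Or.inl ⟨t * j, htj, h⟩
    · exact Or.inr h
  rw [probReal_univ] at h3
  linarith

/-! ### The potential of the whole process -/

/-- A crude potential, which uses only that consensus is possible in one round: all nodes may
sample the same node. -/
lemma avg_card_mul_unsettled {χ : Coloring n} (h : ¬ IsConsensus χ) :
    avg (fun χ ↦ (Fintype.card (Fin n → NodeChoice n) : ℝ) * unsettled χ) χ ≤
      Fintype.card (Fin n → NodeChoice n) * unsettled χ - 1 := by
  have hs : IsConsensus (step χ fun _ ↦ (fun _ ↦ 0, 0)) := ⟨χ 0, fun v ↦ by simp [step, adopt]⟩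
  have h1 : ∑ s : Fin n → NodeChoice n, unsettled (step χ s) ≤
      ∑ s : Fin n → NodeChoice n, 1 - 1 := by
    rw [← add_sum_erase _ _ (mem_univ fun _ : Fin n ↦ ((fun _ ↦ 0, 0) : NodeChoice n)),
      ← add_sum_erase _ (fun _ ↦ (1 : ℝ))
        (mem_univ fun _ : Fin n ↦ ((fun _ ↦ 0, 0) : NodeChoice n)),
      unsettled, if_pos hs, zero_add, add_sub_cancel_left]
    refine sum_le_sum fun s _ ↦ ?_
    rw [unsettled]; split_ifs <;> norm_num
  simp only [avg, ← mul_expect]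
  rw [Fintype.card_mul_expect, unsettled, if_neg h, mul_one]
  simpa using h1

/-- The potential used for large `n`: while more than `k` colors survive, progress is measured by
`reductionPotential`; afterwards, colors are lost one by one, and the progress towards the loss of
the next one is measured by `lossPotential`, scaled to have drift at least `1`. The number `τ` is
a bound for the time that the loss of one color takes. -/
noncomputable def totalPotential (k : ℕ) (b τ : ℝ) (χ : Coloring n) : ℝ :=
  if #(colors χ) ≤ k then
    #(colors χ) * τ + (8 * k + 48 * (n * b)) * lossPotential #(colors χ) b χ
  else (k + 1) * τ + reductionPotential k χ

/-- The time `τ` that is allowed for the loss of one of at most `k` colors. -/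
noncomputable def lossTime (n k : ℕ) (b : ℝ) : ℝ :=
  (8 * k + 48 * (n * b)) * (2 * (Real.log 2 + Real.log n))

lemma lossTime_nonneg (k : ℕ) {b : ℝ} (hb : 0 ≤ b) : 0 ≤ lossTime n k b := by
  have hn := natCast_pos (n := n)
  have hl : 0 ≤ Real.log n := Real.log_nonneg (Nat.one_le_cast.2 (NeZero.one_le))
  have hl2 := Real.log_nonneg (show (1 : ℝ) ≤ 2 by norm_num)
  rw [lossTime]
  positivity

section

variable {k : ℕ} {b : ℝ}

lemma totalPotential_le_of_le (hb : 1 / n ≤ b) {χ : Coloring n} (h : #(colors χ) ≤ k) :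
    totalPotential k b (lossTime n k b) χ ≤ (#(colors χ) + 1) * lossTime n k b := by
  have hn := natCast_pos (n := n)
  have hb0 : 0 ≤ b := le_trans (by positivity) hb
  have h1 := mul_le_mul_of_nonneg_left (lossPotential_le (χ := χ) le_rfl hb)
    (show 0 ≤ 8 * (k : ℝ) + 48 * (n * b) by positivity)
  rw [← lossTime] at h1
  rw [totalPotential, if_pos h]
  linarith

lemma totalPotential_nonneg (hb0 : 0 < b) (hb1 : b ≤ 1) (χ : Coloring n) :
    0 ≤ totalPotential k b (lossTime n k b) χ := by
  have hn := natCast_pos (n := n)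
  have h1 := lossTime_nonneg (n := n) k hb0.le
  have h2 := lossPotential_nonneg (χ := χ) le_rfl hb0 hb1
  have h3 := reductionPotential_nonneg k χ
  rw [totalPotential]
  split_ifs <;> positivity

lemma totalPotential_le (hb : 1 / n ≤ b) (χ : Coloring n) :
    totalPotential k b (lossTime n k b) χ ≤ (k + 1) * lossTime n k b
      + (12 * n / k * Real.log n + 8 * (Real.log 2 + Real.log n)) := by
  have hn := natCast_pos (n := n)
  by_cases h : #(colors χ) ≤ k
  · have h1 := totalPotential_le_of_le hb h
    have h2 : (#(colors χ) + 1) * lossTime n k b ≤ (k + 1) * lossTime n k b := by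
      have := lossTime_nonneg (n := n) k (le_trans (by positivity) hb)
      gcongr
    linarith [reductionPotential_nonneg k χ, reductionPotential_le k χ]
  · rw [totalPotential, if_neg h]
    linarith [reductionPotential_le k χ]

lemma totalPotential_drift (hk : 1 ≤ k) (hb1 : b ≤ 1 / 20)
    (hb : n * b = 192 * (2 + 4 * Real.log n)) {χ : Coloring n} (hχ : ¬ IsConsensus χ) :
    avg (totalPotential k b (lossTime n k b)) χ ≤
      totalPotential k b (lossTime n k b) χ - 1 := by
  have hn := natCast_pos (n := n)
  have hl : 0 ≤ Real.log n := Real.log_nonneg (Nat.one_le_cast.2 (NeZero.one_le))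
  have hb' : 1 / n ≤ b := by
    rw [div_le_iff₀' hn]; linarith
  have hb0 : 0 < b := lt_of_lt_of_le (by positivity) hb'
  have hτ := lossTime_nonneg (n := n) k hb0.le
  rw [isConsensus_iff, not_le] at hχ
  set τ := lossTime n k b with hτdef
  by_cases h : #(colors χ) ≤ k
  · set D : ℝ := 8 * k + 48 * (n * b) with hD
    have hD0 : 0 ≤ D := by positivity
    have pt : ∀ s, totalPotential k b τ (step χ s) ≤
        #(colors χ) * τ + D * lossPotential #(colors χ) b (step χ s) := by
      intro s
      have hle := card_le_card (colors_step_subset χ s)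
      rcases hle.eq_or_lt with he | hlt
      · rw [totalPotential, if_pos (hle.trans h), he]
      · refine (totalPotential_le_of_le hb' (hle.trans h)).trans ?_
        have h1 : ((#(colors (step χ s)) : ℝ) + 1) * τ ≤ #(colors χ) * τ := by
          gcongr
          exact_mod_cast hlt
        have h2 := mul_nonneg hD0 (lossPotential_nonneg hle hb0 (by linarith))
        linarith
    have h1 : avg (totalPotential k b τ) χ ≤
        #(colors χ) * τ + D * avg (lossPotential #(colors χ) b) χ :=
      (expect_mono pt).trans_eq (avg_const_add_mul _ _ _ χ)
    have h2 := mul_le_mul_of_nonneg_left (lossPotential_drift hχ rfl hb1 hb) hD0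
    have h3 : 1 ≤ D * (1 / (8 * #(colors χ) + 48 * (n * b))) := by
      rw [mul_one_div, one_le_div (by positivity), hD]
      gcongr
    rw [totalPotential, if_pos h]
    linarith
  · have pt : ∀ s, totalPotential k b τ (step χ s) ≤
        (k + 1) * τ + 1 * reductionPotential k (step χ s) := by
      intro s
      by_cases h' : #(colors (step χ s)) ≤ k
      · refine (totalPotential_le_of_le hb' h').trans ?_
        have h1 : ((#(colors (step χ s)) : ℝ) + 1) * τ ≤ (k + 1) * τ := by gcongr
        linarith [reductionPotential_nonneg k (step χ s)]
      · rw [totalPotential, if_neg h', one_mul]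
    have h1 : avg (totalPotential k b τ) χ ≤ (k + 1) * τ + 1 * avg (reductionPotential k) χ :=
      (expect_mono pt).trans_eq (avg_const_add_mul _ _ _ χ)
    have h2 := reductionPotential_drift hk (not_le.1 h)
    rw [totalPotential, if_neg h]
    linarith

end

end

/-! ### Choice of the parameters -/

/-- For large `n`, with `k` about `n ^ (1 / 3)`, the time bound of the potential argument is of
smaller order than `n ^ (3 / 4)`. -/
lemma exists_totalPotential_bound : ∃ (n₀ : ℕ) (C : ℝ), 0 < C ∧ ∀ n : ℕ, n₀ ≤ n → ∃ (k : ℕ) (b : ℝ),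
    1 ≤ k ∧ b ≤ 1 / 20 ∧ n * b = 192 * (2 + 4 * Real.log n) ∧
    (2 * ((k + 1) * lossTime n k b + (12 * n / k * Real.log n + 8 * (Real.log 2 + Real.log n)))
      + 1) * (2 * Real.log n + 1) ≤ C * (n : ℝ) ^ (3 / 4 : ℝ) := by
  -- With this threshold, `z = n ^ (1 / 36)` is at least `2`, and `z ^ 35` absorbs the constants in
  -- the condition `b ≤ 1 / 20`.
  refine ⟨2 ^ 36, 10 ^ 13, by positivity, fun n hn ↦ ?_⟩
  have hn2 : (2 : ℝ) ^ 36 ≤ n := by exact_mod_cast hn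
  have hn0 : (0 : ℝ) < n := lt_of_lt_of_le (by positivity) hn2
  -- All powers of `n` that occur are powers of `z`.
  obtain ⟨z, hz2, hzn, hz34, hlog⟩ : ∃ z : ℝ, 2 ≤ z ∧ z ^ 36 = n ∧
      (n : ℝ) ^ (3 / 4 : ℝ) = z ^ 27 ∧ Real.log n ≤ 36 * z := by
    have hz36 : ((n : ℝ) ^ (1 / 36 : ℝ)) ^ 36 = n := by
      rw [← Real.rpow_natCast, ← Real.rpow_mul hn0.le]; norm_num
    refine ⟨(n : ℝ) ^ (1 / 36 : ℝ), ?_, hz36, ?_, ?_⟩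
    · refine le_of_pow_le_pow_left₀ (n := 36) (by norm_num) (by positivity) ?_
      rwa [hz36]
    · rw [← Real.rpow_natCast, ← Real.rpow_mul hn0.le]; norm_num
    · have h := Real.log_le_rpow_div hn0.le (show (0 : ℝ) < 1 / 36 by norm_num)
      linarith
  have hz1 : 1 ≤ z := by linarith
  have hl : 0 ≤ Real.log n := Real.log_nonneg (le_trans (by norm_num) hn2)
  have hl2 : Real.log 2 ≤ 1 := by linarith [Real.log_two_lt_d9]
  have hl20 : 0 ≤ Real.log 2 := Real.log_nonneg (by norm_num)
  have hk1 : z ^ 12 ≤ ⌈z ^ 12⌉₊ := Nat.le_ceil _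
  have hk2 : (⌈z ^ 12⌉₊ : ℝ) ≤ 2 * z ^ 12 := by
    have := (Nat.ceil_lt_add_one (show 0 ≤ z ^ 12 by positivity)).le
    linarith [one_le_pow₀ hz1 (n := 12)]
  have hN : 192 * (2 + 4 * Real.log n) ≤ 28032 * z := by linarith
  refine ⟨⌈z ^ 12⌉₊, 192 * (2 + 4 * Real.log n) / n, Nat.ceil_pos.2 (by positivity), ?_, ?_, ?_⟩
  · rw [div_le_div_iff₀ hn0 (by norm_num), ← hzn]
    have h35 : (2 : ℝ) ^ 35 ≤ z ^ 35 := pow_le_pow_left₀ (by norm_num) hz2 35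
    have h1 := mul_le_mul_of_nonneg_left h35 (show 0 ≤ z by linarith)
    have h2 : z * z ^ 35 = z ^ 36 := by ring
    have h3 : 560640 * z ≤ z * 2 ^ 35 := by
      rw [mul_comm]; gcongr; norm_num
    rw [hzn] at *
    linarith
  · field_simp
  · set K : ℝ := ((⌈z ^ 12⌉₊ : ℕ) : ℝ) with hK
    have hnb : (n : ℝ) * (192 * (2 + 4 * Real.log n) / n) = 192 * (2 + 4 * Real.log n) := by
      field_simp
    have hz12 : z ≤ z ^ 12 := le_self_pow₀ hz1 (by norm_num)
    have hτ : lossTime n ⌈z ^ 12⌉₊ (192 * (2 + 4 * Real.log n) / n) ≤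
        100000000 * (z ^ 12 * z) := by
      rw [lossTime, hnb]
      calc (8 * K + 48 * (192 * (2 + 4 * Real.log n))) * (2 * (Real.log 2 + Real.log n))
          ≤ (8 * (2 * z ^ 12) + 48 * (28032 * z ^ 12)) * (2 * (z + 36 * z)) :=
            mul_le_mul (by linarith) (by linarith) (by positivity) (by positivity)
        _ = 99570848 * (z ^ 12 * z) := by ring
        _ ≤ _ := by gcongr; norm_num
    have hτ' : (K + 1) * lossTime n ⌈z ^ 12⌉₊ (192 * (2 + 4 * Real.log n) / n) ≤
        300000000 * z ^ 25 := by
      have hK3 : K + 1 ≤ 3 * z ^ 12 := by linarith [one_le_pow₀ hz1 (n := 12)]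
      have : NeZero n := ⟨by omega⟩
      calc _ ≤ (3 * z ^ 12) * (100000000 * (z ^ 12 * z)) :=
            mul_le_mul hK3 hτ (lossTime_nonneg _ (by positivity)) (by positivity)
        _ = _ := by ring
    have hred : 12 * n / K * Real.log n ≤ 432 * z ^ 25 := by
      have hz0 : 0 < z ^ 12 := by positivity
      calc 12 * n / K * Real.log n ≤ 12 * n / z ^ 12 * (36 * z) := by gcongr
        _ = 432 * z ^ 25 := by rw [← hzn]; field_simp; ring
    have hlast : 8 * (Real.log 2 + Real.log n) ≤ 296 * z ^ 25 := by
      have : z ≤ z ^ 25 := le_self_pow₀ hz1 (by norm_num)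
      linarith
    have h25 : 1 ≤ z ^ 25 := one_le_pow₀ hz1
    have h27 : z ^ 25 * z ≤ z ^ 27 := by
      rw [← pow_succ]; exact pow_le_pow_right₀ hz1 (by norm_num)
    rw [hz34]
    calc _ ≤ (2 * (300000000 * z ^ 25 + (432 * z ^ 25 + 296 * z ^ 25)) + z ^ 25)
            * (2 * (36 * z) + z) := by gcongr
      _ = 43800106361 * (z ^ 25 * z) := by ring
      _ ≤ 10 ^ 13 * z ^ 27 := by
          gcongr
          norm_num

end ThreeMajority

theorem mainTheorem1 :
    ∃ C : ℝ, 0 < C ∧ ∀ (n : ℕ) [NeZero n] (χ : ThreeMajority.Coloring n),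
      1 - 1 / (n : ℝ) ≤
        (ThreeMajority.law n).real
          {ω | ∃ t : ℕ,
            (t : ℝ) ≤ C * ((n : ℝ) ^ (3 / 4 : ℝ) * Real.log (n : ℝ) ^ (7 / 8 : ℝ)) ∧
            ThreeMajority.IsConsensus (ThreeMajority.run χ ω t)} := by
  obtain ⟨n₀, C, hC, hlarge⟩ := ThreeMajority.exists_totalPotential_bound
  let M : ℕ → ℝ := fun n ↦ Fintype.card (Fin n → ThreeMajority.NodeChoice n)
  let f : ℕ → ℝ := fun n ↦ (2 * M n + 1) * (2 * Real.log n + 1)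
  have hf : ∀ n, 0 ≤ f n := fun n ↦ by
    have := Real.log_natCast_nonneg n
    positivity
  set C₀ : ℝ := ∑ n ∈ Finset.range n₀, f n with hC₀
  have hC₀0 : 0 ≤ C₀ := Finset.sum_nonneg fun n _ ↦ hf n
  refine ⟨2 * (C + C₀), by positivity, fun n _ χ ↦ ?_⟩
  have hn1 : 1 ≤ n := NeZero.one_le
  rcases hn1.eq_or_lt with rfl | hn2
  · simp
  have hn2' : (2 : ℝ) ≤ n := by exact_mod_cast hn2
  have hn34 : 1 ≤ (n : ℝ) ^ (3 / 4 : ℝ) := Real.one_le_rpow (by linarith) (by norm_num)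
  have hlog : 1 / 2 ≤ Real.log n ^ (7 / 8 : ℝ) := by
    have h1 : 1 / 2 ≤ Real.log n := by
      linarith [Real.log_two_gt_d9, Real.log_le_log (by norm_num) hn2']
    calc (1 / 2 : ℝ) = (1 / 2 : ℝ) ^ (1 : ℝ) := (Real.rpow_one _).symm
      _ ≤ (1 / 2 : ℝ) ^ (7 / 8 : ℝ) :=
        Real.rpow_le_rpow_of_exponent_ge (by norm_num) (by norm_num) (by norm_num)
      _ ≤ _ := Real.rpow_le_rpow (by norm_num) h1 (by norm_num)
  have hT : (C + C₀) * (n : ℝ) ^ (3 / 4 : ℝ) ≤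
      2 * (C + C₀) * ((n : ℝ) ^ (3 / 4 : ℝ) * Real.log n ^ (7 / 8 : ℝ)) := by
    have h := mul_le_mul_of_nonneg_left hlog
      (show 0 ≤ 2 * ((C + C₀) * (n : ℝ) ^ (3 / 4 : ℝ)) by positivity)
    linarith
  rcases lt_or_ge n n₀ with hlt | hge
  · refine ThreeMajority.one_sub_inv_le_measureReal_isConsensus (M := M n)
      (Φ := fun χ ↦ M n * ThreeMajority.unsettled χ)
      (fun χ ↦ mul_nonneg (by positivity) (ThreeMajority.unsettled_nonneg χ))
      (fun χ ↦ ThreeMajority.avg_card_mul_unsettled)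
      (fun χ ↦ mul_le_of_le_one_right (by positivity) ?_) χ (le_trans ?_ hT)
    · rw [ThreeMajority.unsettled]; split_ifs <;> norm_num
    · have h1 : f n ≤ C₀ :=
        Finset.single_le_sum (f := f) (fun n _ ↦ hf n) (Finset.mem_range.2 hlt)
      calc f n ≤ (C + C₀) * 1 := by linarith
        _ ≤ _ := by gcongr
  · obtain ⟨k, b, hk, hb1, hb, hbound⟩ := hlarge n hge
    have hn0 : (0 : ℝ) < n := by linarith
    have hb' : 1 / n ≤ b := by
      rw [div_le_iff₀' hn0, hb]
      linarith [Real.log_natCast_nonneg n]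
    have hb0 : 0 < b := lt_of_lt_of_le (by positivity) hb'
    refine ThreeMajority.one_sub_inv_le_measureReal_isConsensus
      (ThreeMajority.totalPotential_nonneg hb0 (by linarith))
      (fun χ hχ ↦ ThreeMajority.totalPotential_drift hk hb1 hb hχ)
      (ThreeMajority.totalPotential_le hb') χ (le_trans hbound (le_trans ?_ hT))
    gcongr
    linarith
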